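/- Let $d=2$ and let $V:\mathbb R\to\mathbb R$ be twice differentiable with $\sup_{t}V''(t)\le 1$, with $V(t)>0$ for all sufficiently large $|t|$, and with $\liminf_{|t|\to\infty}\frac{\log V(t)}{\log|t|}>1$. For a finite set $\Lambda\subset\mathbb Z^d$, a field configuration $\eta=(\eta_i)_{i\in\mathbb Z^d}\in\mathbb R^{\mathbb Z^d}$ and a pinning strength $0\le\varepsilon<\infty$, let $\mu_{\varepsilon,\Lambda}[\eta]$ be the probability measure on $\mathbb R^{\Lambda}$ given by $$\mu_{\varepsilon,\Lambda}[\eta](d\varphi)=\frac{1}{Z_{\varepsilon,\Lambda}[\eta]}\exp\Bigl(-\frac1{4d}\sum_{\langle i,j\rangle\in\Lambda}V(\varphi_i-\varphi_j)-\frac1{4d}\sum_{i\in\Lambda,\,j\in\Lambda^c,\,|i-j|=1}V(\varphi_i)+\sum_{i\in\Lambda}\eta_i\varphi_i\Bigr)\prod_{i\in\Lambda}\bigl(d\varphi_i+\varepsilon\,\delta_0(d\varphi_i)\bigr),$$ where $Z_{\varepsilon,\Lambda}[\eta]$ is the normalizing constant and the first sum runs over the nearest-neighbour bonds with both ends in $\Lambda$,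 each bond counted once (if $V$ is not even, a bond is written with $i<j$ in the coordinatewise order). Let $\Lambda_L=\{-L,\dots,L\}^2$. Then there is a constant $a>0$ (which may depend on $V$, but not on the distribution of the random fields nor on $\varepsilon$) such that, whenever the $\eta_i$, $i\in\mathbb Z^2$, are i.i.d. centered Gaussian random variables with strictly positive variance of arbitrary size, and for every $0\le\varepsilon<\infty$, $$\liminf_{L\to\infty}\frac1{L^2\log L}\sum_{i\in\Lambda_L}\mathbb E\Bigl(\mu_{\varepsilon,\Lambda_L}[\eta](\varphi_i^2)-\mu_{\varepsilon,\Lambda_L}[\eta](\varphi_i)^2\Bigr)\ge a .$$ -/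

import Mathlib

open MeasureTheory ProbabilityTheory Filter
open scoped NNReal ENNReal

noncomputable section

/-- Sites of the lattice `ℤ^d`. -/
abbrev Site (d : ℕ) : Type := Fin d → ℤ

/-- `i` and `j` are nearest neighbours, `|i - j| = 1`. -/
def NearestNeighbour {d : ℕ} (i j : Site d) : Prop := ∑ k, |i k - j k| = 1

open Classical in
/-- `∑_{⟨i,j⟩ ∈ Λ} V(φ_i - φ_j)`: every nearest-neighbour bond inside `Λ` is counted once.
Nearest neighbours are comparable in the coordinatewise order, so `i < j` selects exactly one of the
two orientations of each bond (the choice is immaterial when `V` is even). -/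
def bulkEnergy {d : ℕ} (V : ℝ → ℝ) (Λ : Finset (Site d)) (φ : Λ → ℝ) : ℝ :=
  ∑ i : Λ, ∑ j : Λ,
    if NearestNeighbour (i : Site d) (j : Site d) ∧ (i : Site d) < (j : Site d)
    then V (φ i - φ j) else 0

open Classical in
/-- `∑_{i ∈ Λ, j ∈ Λᶜ, |i - j| = 1} V(φ_i)`, the interaction with the zero boundary condition.
All nearest neighbours of `i` lie in the cube `Icc (i - 1) (i + 1)`. -/
def boundaryEnergy {d : ℕ} (V : ℝ → ℝ) (Λ : Finset (Site d)) (φ : Λ → ℝ) : ℝ :=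
  ∑ i : Λ, ∑ _j ∈ (Finset.Icc ((i : Site d) - 1) ((i : Site d) + 1)).filter
    (fun j => j ∉ Λ ∧ NearestNeighbour (i : Site d) j), V (φ i)

/-- The exponent of the Gibbs density in the volume `Λ` with external fields `η`. -/
def gibbsExponent {d : ℕ} (V : ℝ → ℝ) (Λ : Finset (Site d)) (η : Site d → ℝ) (φ : Λ → ℝ) : ℝ :=
  -(1 / (4 * (d : ℝ))) * bulkEnergy V Λ φ - (1 / (4 * (d : ℝ))) * boundaryEnergy V Λ φ
    + ∑ i : Λ, η i * φ i

/-- The reference measure `∏_{i ∈ Λ} (dφ_i + ε δ₀(dφ_i))`. -/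
def pinningMeasure {d : ℕ} (ε : ℝ≥0) (Λ : Finset (Site d)) : Measure (Λ → ℝ) :=
  Measure.pi fun _ : Λ => (volume : Measure ℝ) + ε • Measure.dirac (0 : ℝ)

/-- The quenched finite-volume Gibbs measure `μ_{ε,Λ}[η]` with zero boundary condition:
the density `exp (gibbsExponent V Λ η)` with respect to the pinning reference measure, normalized
by the partition function. -/
def gibbsMeasure {d : ℕ} (V : ℝ → ℝ) (ε : ℝ≥0) (Λ : Finset (Site d)) (η : Site d → ℝ) :
    Measure (Λ → ℝ) :=
  (pinningMeasure ε Λ).tilted (gibbsExponent V Λ η)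

/-- The quenched variance `μ_{ε,Λ}[η](φ_i²) - μ_{ε,Λ}[η](φ_i)²`. -/
def quenchedVariance {d : ℕ} (V : ℝ → ℝ) (ε : ℝ≥0) (Λ : Finset (Site d)) (η : Site d → ℝ)
    (i : Λ) : ℝ :=
  (∫ φ, φ i ^ 2 ∂(gibbsMeasure V ε Λ η)) - (∫ φ, φ i ∂(gibbsMeasure V ε Λ η)) ^ 2

/-- The cube of side length `2L + 1` centred at the origin. -/
def box (d L : ℕ) : Finset (Site d) := Finset.Icc (fun _ => -(L : ℤ)) (fun _ => (L : ℤ))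

end

/-! The argument compares fluctuations with free energy. Write `⟨·⟩_x` for the quenched expectation
in the field `x` and `Z_ε(x)` for the partition function. For Gaussian fields of variance `v`,
integration by parts turns the variance into an overlap: `v E Var(φ_i) = E[x_i ⟨φ_i⟩_x]`
(`integral_mul_tiltMean`). By Jensen, the total overlap satisfies `∑ x_i ⟨φ_i⟩_x ≥ log Z_ε(x) - log
Z_ε(0)` (`log_partitionFn_sub_le`), so a lower bound on the mean free energy gain is enough.

Pinning only increases `Z_ε(x)`, so in the presence of the field it may be replaced by `Z_0(x)`,
where the reference measure is Lebesgue measure and translations are available. Since `V'' ≤ 1`,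
shifting `φ` by `±h` in the fields `±x` costs at most the quadratic energy `Q(h)`, namely `energy`
with potential `t ^ 2`. This gives `log Z_0(x) + log Z_0(-x) ≥ 2 log Z_0(0) + 2 ∑ x_i h_i - Q(h) /
8` (`log_partitionFn_add_log_partitionFn_neg`).

The shift is taken linear in the field, `h = ∑_j x_j u_j`. Averaging removes the cross terms and
leaves `v ∑_j (u_j(j) - Q(u_j) / 16)` (`mul_sum_integral_tiltVar_ge`). In two dimensions a multiple
of a logarithmic profile around `j` has both height and energy of order `log L`, and a suitable
multiple makes the difference a positive multiple of `log L` for order `L ^ 2` centres `j`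
(`sum_trialShift_ge`).

The remaining error `log Z_0(0) - log Z_ε(0)` is of volume order (`exp_le_partitionFn`,
`exists_partitionFn_zero_le`), hence negligible against `L ^ 2 log L`. The main term is proportional
to `v`, so `v` cancels there; `v` and `ε` survive only in the negligible error. The superlinear
growth of `V` provides the integrability behind all these manipulations. -/

noncomputable section

/-! ### Linearly tilted measures: moment bounds and Jensen's inequality. -/

section AbstractTilt

variable {ι : Type*} [Fintype ι]

/-- The exponent `W` perturbed by the linear field `x`. -/
def linTilt (W : (ι → ℝ) → ℝ) (x φ : ι → ℝ) : ℝ := W φ + ∑ i, x i * φ i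

/-- The partition function of the weight `exp W` in the field `x`. -/
def partitionFn (ν : Measure (ι → ℝ)) (W : (ι → ℝ) → ℝ) (x : ι → ℝ) : ℝ :=
  ∫ φ, Real.exp (linTilt W x φ) ∂ν

/-- Integrability and growth conditions on a weight `exp W` which make all fields admissible, with
polynomially growing moments. -/
structure SuperlinearWeight (ν : Measure (ι → ℝ)) (W : (ι → ℝ) → ℝ) (C : ℝ) (m : ℕ) : Prop where
  nonneg : 0 ≤ C
  measurable : Measurable W
  integrable : Integrable (fun φ => Real.exp (-∑ i, |φ i|)) ν
  upper : ∀ s, 0 ≤ s → ∀ φ, W φ ≤ -s * ∑ i, |φ i| + C * (1 + s) ^ m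
  lower : ∀ x : ι → ℝ, Real.exp (-(C * (1 + ∑ i, |x i|))) ≤ partitionFn ν W x

lemma measurable_linTilt {W : (ι → ℝ) → ℝ} (hW : Measurable W) :
    Measurable (fun p : (ι → ℝ) × (ι → ℝ) => linTilt W p.1 p.2) := by
  unfold linTilt
  fun_prop

lemma measurable_linTilt_right {W : (ι → ℝ) → ℝ} (hW : Measurable W) (x : ι → ℝ) :
    Measurable (linTilt W x) := by
  unfold linTilt
  fun_prop

lemma sum_mul_le_sum_abs_mul_sum_abs (x φ : ι → ℝ) :
    ∑ i, x i * φ i ≤ (∑ i, |x i|) * ∑ i, |φ i| := by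
  rw [Finset.sum_mul]
  refine Finset.sum_le_sum fun i _ => ?_
  calc x i * φ i ≤ |x i| * |φ i| := by rw [← abs_mul]; exact le_abs_self _
    _ ≤ |x i| * ∑ j, |φ j| := by
      gcongr
      exact Finset.single_le_sum (f := fun j => |φ j|) (fun j _ => abs_nonneg _) (Finset.mem_univ i)

namespace SuperlinearWeight

variable {ν : Measure (ι → ℝ)} {W : (ι → ℝ) → ℝ} {C : ℝ} {m : ℕ}

/-- The growth bound is used with slope `1 + a + ∑ |x i|`: the last part absorbs the field, `a` pays
for the exponential moment, and the remaining `1` leaves an integrable factor. -/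
lemma exp_bound (h : SuperlinearWeight ν W C m) {a : ℝ} (ha : 0 ≤ a) (x φ : ι → ℝ) :
    Real.exp (a * ∑ i, |φ i|) * Real.exp (linTilt W x φ) ≤
      Real.exp (C * (2 + a + ∑ i, |x i|) ^ m) * Real.exp (-∑ i, |φ i|) := by
  rw [← Real.exp_add, ← Real.exp_add]
  apply Real.exp_le_exp.2
  have hx : 0 ≤ ∑ i, |x i| := Finset.sum_nonneg fun _ _ => abs_nonneg _
  have h1 := h.upper (1 + a + ∑ i, |x i|) (by positivity) φ
  have h2 := sum_mul_le_sum_abs_mul_sum_abs x φ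
  have e : (1 + (1 + a + ∑ i, |x i|)) = 2 + a + ∑ i, |x i| := by ring
  rw [e] at h1
  unfold linTilt
  nlinarith

lemma integrable_exp (h : SuperlinearWeight ν W C m) {a : ℝ} (ha : 0 ≤ a) (x : ι → ℝ) :
    Integrable (fun φ => Real.exp (a * ∑ i, |φ i|) * Real.exp (linTilt W x φ)) ν := by
  have hm := measurable_linTilt_right h.measurable x
  refine Integrable.mono' (h.integrable.const_mul (Real.exp (C * (2 + a + ∑ i, |x i|) ^ m)))
    (Measurable.aestronglyMeasurable ?_) (ae_of_all _ fun φ => ?_)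
  · exact (by fun_prop : Measurable fun φ : ι → ℝ => Real.exp (a * ∑ i, |φ i|)).mul
      (Real.measurable_exp.comp hm)
  · rw [Real.norm_of_nonneg (by positivity)]
    exact h.exp_bound ha x φ

lemma integrable_exp_linTilt (h : SuperlinearWeight ν W C m) (x : ι → ℝ) :
    Integrable (fun φ => Real.exp (linTilt W x φ)) ν := by
  simpa using h.integrable_exp le_rfl x

lemma partitionFn_pos (h : SuperlinearWeight ν W C m) (x : ι → ℝ) : 0 < partitionFn ν W x :=
  (Real.exp_pos _).trans_le (h.lower x)

lemma neZero (h : SuperlinearWeight ν W C m) : NeZero ν := by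
  refine ⟨fun h0 => ?_⟩
  have := h.partitionFn_pos 0
  simp [partitionFn, h0] at this

lemma isProbabilityMeasure (h : SuperlinearWeight ν W C m) (x : ι → ℝ) :
    IsProbabilityMeasure (ν.tilted (linTilt W x)) :=
  have := h.neZero
  isProbabilityMeasure_tilted (h.integrable_exp_linTilt x)

lemma integrable_tilted_exp (h : SuperlinearWeight ν W C m) {a : ℝ} (ha : 0 ≤ a) (x : ι → ℝ) :
    Integrable (fun φ => Real.exp (a * ∑ i, |φ i|)) (ν.tilted (linTilt W x)) := by
  rw [integrable_tilted_iff (h.integrable_exp_linTilt x)]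
  simpa [mul_comm] using h.integrable_exp ha x

lemma integral_tilted_exp_le (h : SuperlinearWeight ν W C m) (x : ι → ℝ) :
    ∫ φ, Real.exp (∑ i, |φ i|) ∂(ν.tilted (linTilt W x)) ≤
      Real.exp ((∫ φ, Real.exp (-∑ i, |φ i|) ∂ν) + C * (3 + ∑ i, |x i|) ^ m
        + C * (1 + ∑ i, |x i|)) := by
  have h1 : ∫ φ, Real.exp (1 * ∑ i, |φ i|) * Real.exp (linTilt W x φ) ∂ν ≤
      Real.exp (C * (2 + 1 + ∑ i, |x i|) ^ m) * ∫ φ, Real.exp (-∑ i, |φ i|) ∂ν := by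
    rw [← integral_const_mul]
    exact integral_mono (h.integrable_exp zero_le_one x) (h.integrable.const_mul _)
      fun φ => h.exp_bound zero_le_one x φ
  have h2 : (∫ φ, Real.exp (-∑ i, |φ i|) ∂ν) ≤ Real.exp (∫ φ, Real.exp (-∑ i, |φ i|) ∂ν) := by
    linarith [Real.add_one_le_exp (∫ φ, Real.exp (-∑ i, |φ i|) ∂ν)]
  have hZ := h.partitionFn_pos x
  have hl := h.lower x
  rw [integral_tilted]
  have e : ∀ φ : ι → ℝ, (Real.exp (linTilt W x φ) / ∫ φ, Real.exp (linTilt W x φ) ∂ν) •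
      Real.exp (∑ i, |φ i|) =
      (Real.exp (1 * ∑ i, |φ i|) * Real.exp (linTilt W x φ)) / partitionFn ν W x := by
    intro φ; simp [partitionFn]; ring
  simp_rw [e]
  rw [integral_div, div_le_iff₀ hZ, Real.exp_add, Real.exp_add]
  have h3 : 1 ≤ Real.exp (C * (1 + ∑ i, |x i|)) * partitionFn ν W x := by
    calc (1 : ℝ) = Real.exp (C * (1 + ∑ i, |x i|)) * Real.exp (-(C * (1 + ∑ i, |x i|))) := by
          rw [← Real.exp_add]; simp
      _ ≤ _ := by gcongr
  have e3 : (2 : ℝ) + 1 = 3 := by norm_num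
  rw [e3] at h1
  calc _ ≤ Real.exp (C * (3 + ∑ i, |x i|) ^ m) * ∫ φ, Real.exp (-∑ i, |φ i|) ∂ν := h1
    _ ≤ Real.exp (C * (3 + ∑ i, |x i|) ^ m) * Real.exp (∫ φ, Real.exp (-∑ i, |φ i|) ∂ν) := by
        gcongr
    _ ≤ (Real.exp (C * (3 + ∑ i, |x i|) ^ m) * Real.exp (∫ φ, Real.exp (-∑ i, |φ i|) ∂ν)) *
        (Real.exp (C * (1 + ∑ i, |x i|)) * partitionFn ν W x) :=
        le_mul_of_one_le_right (by positivity) h3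
    _ = _ := by ring

/-- This converts a bound `exp M` on an exponential moment into a bound `2 * M ^ 2` on a second
moment. The gain is essential: the available exponential moments are exponentials of polynomials in
the field, which need not be Gaussian integrable, whereas `M ^ 2` is polynomial. -/
lemma sq_le_sq_mul_one_add_exp {t M : ℝ} (hM : 2 ≤ M) (ht : 0 ≤ t) :
    t ^ 2 ≤ M ^ 2 * (1 + Real.exp (-M) * Real.exp t) := by
  rw [← Real.exp_add]
  rcases le_total t M with h | h
  · have : t ^ 2 ≤ M ^ 2 := by gcongr
    nlinarith [Real.exp_pos (-M + t), sq_nonneg M]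
  -- Above the threshold, `exp y ≥ 1 + y` gives this because `M / 2 ≥ 1`.
  · have h1 : t ≤ M * Real.exp ((t - M) / 2) := by
      have := Real.add_one_le_exp ((t - M) / 2)
      nlinarith
    have h2 : t ^ 2 ≤ (M * Real.exp ((t - M) / 2)) ^ 2 := by gcongr
    rw [mul_pow, ← Real.exp_nat_mul] at h2
    have e : ((2 : ℕ) : ℝ) * ((t - M) / 2) = -M + t := by push_cast; ring
    rw [e] at h2
    nlinarith [sq_nonneg M]

/-- A polynomial bound for second moments. -/
def momentBound (ν : Measure (ι → ℝ)) (C : ℝ) (m : ℕ) (x : ι → ℝ) : ℝ :=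
  2 * (2 + (∫ φ, Real.exp (-∑ i, |φ i|) ∂ν) + 2 * C) ^ 2 * (3 + ∑ i, |x i|) ^ (2 * (m + 1))

lemma integrable_sq (h : SuperlinearWeight ν W C m) (x : ι → ℝ) (i : ι) :
    Integrable (fun φ => φ i ^ 2) (ν.tilted (linTilt W x)) := by
  have := h.isProbabilityMeasure x
  refine Integrable.mono' (g := fun φ => 2 ^ 2 * (1 + Real.exp (-2) * Real.exp (1 * ∑ i, |φ i|)))
    ?_ ((measurable_pi_apply i).pow_const 2).aestronglyMeasurable (ae_of_all _ fun φ => ?_)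
  · exact ((integrable_const _).add ((h.integrable_tilted_exp zero_le_one x).const_mul _)).const_mul _
  · rw [Real.norm_of_nonneg (by positivity), ← sq_abs]
    refine (sq_le_sq_mul_one_add_exp le_rfl (abs_nonneg _)).trans ?_
    gcongr
    rw [one_mul]
    exact Finset.single_le_sum (f := fun j => |φ j|) (fun j _ => abs_nonneg _) (Finset.mem_univ i)

lemma memLp_two (h : SuperlinearWeight ν W C m) (x : ι → ℝ) (i : ι) :
    MemLp (fun φ : ι → ℝ => φ i) 2 (ν.tilted (linTilt W x)) :=
  (memLp_two_iff_integrable_sq (measurable_pi_apply i).aestronglyMeasurable).2 (h.integrable_sq x i)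

lemma integrable_coord (h : SuperlinearWeight ν W C m) (x : ι → ℝ) (i : ι) :
    Integrable (fun φ : ι → ℝ => φ i) (ν.tilted (linTilt W x)) :=
  have := h.isProbabilityMeasure x
  (h.memLp_two x i).integrable one_le_two

lemma integral_sq_le (h : SuperlinearWeight ν W C m) (x : ι → ℝ) (i : ι) :
    ∫ φ, φ i ^ 2 ∂(ν.tilted (linTilt W x)) ≤ momentBound ν C m x := by
  have := h.isProbabilityMeasure x
  have hC := h.nonneg
  set I := ∫ φ, Real.exp (-∑ i, |φ i|) ∂ν with hI
  have hI0 : 0 ≤ I := integral_nonneg fun φ => (Real.exp_pos _).le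
  set s := ∑ i, |x i| with hs
  have hs0 : 0 ≤ s := Finset.sum_nonneg fun _ _ => abs_nonneg _
  -- `M` exceeds the logarithm of the bound in `integral_tilted_exp_le` by `2`, so that `exp (-M)`
  -- times the exponential moment is at most `1`.
  set M := 2 + I + C * (3 + s) ^ m + C * (1 + s) with hM
  have hM2 : 2 ≤ M := by
    have : 0 ≤ C * (3 + s) ^ m := by positivity
    have : 0 ≤ C * (1 + s) := by positivity
    linarith
  have hint : Integrable (fun φ : ι → ℝ => Real.exp (∑ i, |φ i|)) (ν.tilted (linTilt W x)) := by
    simpa using h.integrable_tilted_exp zero_le_one x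
  have h1 : ∫ φ, φ i ^ 2 ∂(ν.tilted (linTilt W x)) ≤
      ∫ φ, M ^ 2 * (1 + Real.exp (-M) * Real.exp (∑ i, |φ i|)) ∂(ν.tilted (linTilt W x)) := by
    refine integral_mono (h.integrable_sq x i)
      (((integrable_const _).add (hint.const_mul _)).const_mul _) fun φ => ?_
    dsimp only
    rw [← sq_abs]
    refine (sq_le_sq_mul_one_add_exp hM2 (abs_nonneg _)).trans ?_
    gcongr
    exact Finset.single_le_sum (f := fun j => |φ j|) (fun j _ => abs_nonneg _) (Finset.mem_univ i)
  rw [integral_const_mul, integral_add (integrable_const _) (hint.const_mul _),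
    integral_const_mul] at h1
  simp only [integral_const, probReal_univ, smul_eq_mul, mul_one] at h1
  have h2 : Real.exp (-M) * ∫ φ, Real.exp (∑ i, |φ i|) ∂(ν.tilted (linTilt W x)) ≤ 1 := by
    calc _ ≤ Real.exp (-M) * Real.exp (I + C * (3 + s) ^ m + C * (1 + s)) := by
          gcongr; exact h.integral_tilted_exp_le x
      _ ≤ 1 := by
          rw [← Real.exp_add]; apply Real.exp_le_one_iff.2; rw [hM]; linarith
  have h3 : M ≤ (2 + I + 2 * C) * (3 + s) ^ (m + 1) := by
    have a1 : (1 : ℝ) ≤ (3 + s) ^ (m + 1) := one_le_pow₀ (by linarith)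
    have a2 : (3 + s) ^ m ≤ (3 + s) ^ (m + 1) := pow_le_pow_right₀ (by linarith) (by omega)
    have a3 : 1 + s ≤ (3 + s) ^ (m + 1) := by
      calc 1 + s ≤ (3 + s) ^ 1 := by rw [pow_one]; linarith
        _ ≤ _ := pow_le_pow_right₀ (by linarith) (by omega)
    have := mul_le_mul_of_nonneg_left a2 hC
    have := mul_le_mul_of_nonneg_left a3 hC
    have := mul_le_mul_of_nonneg_left a1 (by linarith : (0:ℝ) ≤ 2 + I)
    rw [hM]; linarith
  calc _ ≤ M ^ 2 * (1 + 1) := h1.trans (by gcongr)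
    _ ≤ ((2 + I + 2 * C) * (3 + s) ^ (m + 1)) ^ 2 * (1 + 1) := by gcongr
    _ = momentBound ν C m x := by unfold momentBound; rw [← hI, ← hs]; ring

lemma abs_integral_le (h : SuperlinearWeight ν W C m) (x : ι → ℝ) (i : ι) :
    |∫ φ, φ i ∂(ν.tilted (linTilt W x))| ≤ 1 + momentBound ν C m x := by
  have := h.isProbabilityMeasure x
  calc |∫ φ, φ i ∂(ν.tilted (linTilt W x))| ≤ ∫ φ, |φ i| ∂(ν.tilted (linTilt W x)) :=
        abs_integral_le_integral_abs
    _ ≤ ∫ φ, (1 + φ i ^ 2) ∂(ν.tilted (linTilt W x)) := by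
        refine integral_mono (h.integrable_coord x i).abs
          ((integrable_const _).add (h.integrable_sq x i)) fun φ => ?_
        dsimp only
        nlinarith [sq_abs (φ i), sq_nonneg (|φ i| - 1), abs_nonneg (φ i)]
    _ ≤ _ := by
        rw [integral_add (integrable_const _) (h.integrable_sq x i)]
        simpa using h.integral_sq_le x i

lemma stronglyMeasurable_integral_tilted [SFinite ν] (h : SuperlinearWeight ν W C m)
    {f : (ι → ℝ) → ℝ} (hf : Measurable f) :
    StronglyMeasurable fun x => ∫ φ, f φ ∂(ν.tilted (linTilt W x)) := by
  have hm := measurable_linTilt h.measurable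
  have e : (fun x => ∫ φ, f φ ∂(ν.tilted (linTilt W x))) =
      fun x => (∫ φ, Real.exp (linTilt W x φ) * f φ ∂ν) / partitionFn ν W x := by
    ext x
    rw [integral_tilted, ← integral_div]
    congr 1 with φ
    simp [partitionFn]; ring
  rw [e]
  have h1 : StronglyMeasurable (fun x => ∫ φ, Real.exp (linTilt W x φ) * f φ ∂ν) := by
    apply StronglyMeasurable.integral_prod_right (f := fun x φ => Real.exp (linTilt W x φ) * f φ)
    exact ((Real.measurable_exp.comp hm).mul (hf.comp measurable_snd)).stronglyMeasurable
  have h2 : StronglyMeasurable (partitionFn ν W) := by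
    apply StronglyMeasurable.integral_prod_right (f := fun x φ => Real.exp (linTilt W x φ))
    exact (Real.measurable_exp.comp hm).stronglyMeasurable
  exact h1.div h2

/-- The mean energy gain of a field dominates the increase of the free energy. -/
lemma log_partitionFn_sub_le (h : SuperlinearWeight ν W C m) (x : ι → ℝ) :
    Real.log (partitionFn ν W x) - Real.log (partitionFn ν W 0) ≤
      ∑ i, x i * ∫ φ, φ i ∂(ν.tilted (linTilt W x)) := by
  have := h.isProbabilityMeasure x
  have hZ := h.partitionFn_pos x
  have hZ0 := h.partitionFn_pos 0
  have hi : Integrable (fun φ : ι → ℝ => ∑ i, x i * φ i) (ν.tilted (linTilt W x)) :=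
    integrable_finsetSum _ fun i _ => (h.integrable_coord x i).const_mul _
  have hM : ∑ i, x i * ∫ φ, φ i ∂(ν.tilted (linTilt W x)) =
      ∫ φ, ∑ i, x i * φ i ∂(ν.tilted (linTilt W x)) := by
    rw [integral_finsetSum _ fun i _ => (h.integrable_coord x i).const_mul _]
    simp_rw [integral_const_mul]
  rw [hM]
  set M := ∫ φ, ∑ i, x i * φ i ∂(ν.tilted (linTilt W x))
  have hexp : ∀ φ, (Real.exp (linTilt W x φ) / ∫ φ, Real.exp (linTilt W x φ) ∂ν) •
      Real.exp (-∑ i, x i * φ i) = Real.exp (linTilt W 0 φ) / partitionFn ν W x := by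
    intro φ
    rw [smul_eq_mul, div_mul_eq_mul_div, ← Real.exp_add]
    simp [linTilt, partitionFn]
  -- Undoing the tilt expresses the ratio of partition functions as an exponential moment under the
  -- tilted measure, to which Jensen's inequality applies.
  have h1 : ∫ φ, Real.exp (-∑ i, x i * φ i) ∂(ν.tilted (linTilt W x)) =
      partitionFn ν W 0 / partitionFn ν W x := by
    rw [integral_tilted]
    simp_rw [hexp]
    rw [integral_div]; rfl
  have hie : Integrable (fun φ : ι → ℝ => Real.exp (-∑ i, x i * φ i)) (ν.tilted (linTilt W x)) := by
    rw [integrable_tilted_iff (h.integrable_exp_linTilt x)]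
    refine (h.integrable_exp_linTilt 0).congr (ae_of_all _ fun φ => ?_)
    dsimp only
    rw [smul_eq_mul, ← Real.exp_add]
    simp [linTilt]
  have h2 : Real.exp (-M) ≤ partitionFn ν W 0 / partitionFn ν W x := by
    rw [← h1]
    -- Jensen's inequality through the tangent line of `exp (-·)` at the mean `M`.
    have : ∫ φ, Real.exp (-M) * (1 + M - ∑ i, x i * φ i) ∂(ν.tilted (linTilt W x)) =
        Real.exp (-M) := by
      rw [integral_const_mul, integral_sub (integrable_const _) hi]
      simp [M]
    rw [← this]
    refine integral_mono (((integrable_const _).sub hi).const_mul _) hie fun φ => ?_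
    have e : Real.exp (-∑ i, x i * φ i) = Real.exp (-M) * Real.exp (M - ∑ i, x i * φ i) := by
      rw [← Real.exp_add]; ring_nf
    dsimp only
    rw [e]
    gcongr
    linarith [Real.add_one_le_exp (M - ∑ i, x i * φ i)]
  have h3 := Real.log_le_log (Real.exp_pos _) h2
  rw [Real.log_exp, Real.log_div hZ0.ne' hZ.ne'] at h3
  linarith

end SuperlinearWeight

end AbstractTilt

/-! ### Gaussian integration by parts for independent fields. -/

section GaussianFields

lemma hasDerivAt_gaussianPDFReal_zero (v : ℝ≥0) (t : ℝ) :
    HasDerivAt (gaussianPDFReal 0 v) (-(t / v) * gaussianPDFReal 0 v t) t := by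
  rcases eq_or_ne v 0 with rfl | hv
  · simp
  have hv' : (v : ℝ) ≠ 0 := by exact_mod_cast hv
  rw [gaussianPDFReal_def]
  have h1 : HasDerivAt (fun x : ℝ => -(x - 0) ^ 2 / (2 * (v : ℝ))) (-(t / v)) t := by
    have := ((((hasDerivAt_id t).sub_const 0).pow 2).neg).div_const (2 * (v : ℝ))
    refine this.congr_deriv ?_
    simp; field_simp
  refine (h1.exp.const_mul _).congr_deriv ?_
  ring

/-- Gaussian integration by parts in dimension one. -/
lemma integral_id_mul_gaussianReal {v : ℝ≥0} (hv : v ≠ 0) {f f' : ℝ → ℝ}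
    (hf : ∀ t, HasDerivAt f (f' t) t) (hi : Integrable f (gaussianReal 0 v))
    (hi1 : Integrable (fun t => t * f t) (gaussianReal 0 v))
    (hi2 : Integrable f' (gaussianReal 0 v)) :
    ∫ t, t * f t ∂(gaussianReal 0 v) = v * ∫ t, f' t ∂(gaussianReal 0 v) := by
  have hv' : (v : ℝ) ≠ 0 := by exact_mod_cast hv
  have key : ∀ g : ℝ → ℝ, Integrable g (gaussianReal 0 v) →
      Integrable (fun t => g t * gaussianPDFReal 0 v t) := by
    intro g hg
    rw [gaussianReal_of_var_ne_zero _ hv,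
      integrable_withDensity_iff (measurable_gaussianPDF _ _)
        (ae_of_all _ fun _ => gaussianPDF_lt_top)] at hg
    simpa [toReal_gaussianPDF] using hg
  have h := integral_mul_deriv_eq_deriv_mul_of_integrable (u := f) (u' := f')
    (v := gaussianPDFReal 0 v) (v' := fun t => -(t / v) * gaussianPDFReal 0 v t)
    (fun t _ => hf t) (fun t _ => hasDerivAt_gaussianPDFReal_zero v t)
    (((key _ hi1).const_mul (-(v : ℝ)⁻¹)).congr (ae_of_all _ fun t => by
      simp only [Pi.mul_apply]; field_simp)) (key _ hi2) (key _ hi)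
  rw [integral_gaussianReal_eq_integral_smul hv, integral_gaussianReal_eq_integral_smul hv]
  have e1 : ∀ t, gaussianPDFReal 0 v t • (t * f t) =
      -v * (f t * (-(t / v) * gaussianPDFReal 0 v t)) := by
    intro t; simp only [smul_eq_mul]; field_simp
  have e2 : ∀ t, gaussianPDFReal 0 v t • f' t = f' t * gaussianPDFReal 0 v t := by
    intro t; simp only [smul_eq_mul]; ring
  simp_rw [e1, e2]
  rw [integral_const_mul, h]
  ring

variable {ι : Type*} [Fintype ι]

/-- The law of a family of independent centred Gaussian variables of variance `v`. -/
abbrev gaussianPi (ι : Type*) [Fintype ι] (v : ℝ≥0) : Measure (ι → ℝ) :=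
  Measure.pi fun _ : ι => gaussianReal 0 v

/-- Resampling one coordinate preserves a product of probability measures. -/
lemma measurePreserving_update_pi [DecidableEq ι] {μ : ι → Measure ℝ}
    [∀ i, IsProbabilityMeasure (μ i)] (i : ι) :
    MeasurePreserving (fun p : (ι → ℝ) × ℝ => Function.update p.1 i p.2)
      ((Measure.pi μ).prod (μ i)) (Measure.pi μ) := by
  have hm : Measurable fun p : (ι → ℝ) × ℝ => Function.update p.1 i p.2 := by
    refine measurable_pi_iff.2 fun j => ?_
    by_cases hj : j = i
    · subst hj; simpa using measurable_snd
    · simpa [hj] using (by fun_prop : Measurable fun p : (ι → ℝ) × ℝ => p.1 j)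
  refine ⟨hm, (Measure.pi_eq fun s hs => ?_).symm⟩
  rw [Measure.map_apply hm (MeasurableSet.univ_pi hs)]
  have e : (fun p : (ι → ℝ) × ℝ => Function.update p.1 i p.2) ⁻¹' (Set.univ.pi s) =
      (Set.univ.pi (Function.update s i Set.univ)) ×ˢ s i := by
    ext ⟨x, t⟩
    simp only [Set.mem_preimage, Set.mem_univ_pi, Set.mem_prod]
    constructor
    · intro h
      refine ⟨fun j => ?_, by simpa using h i⟩
      by_cases hj : j = i
      · subst hj; simp
      · simpa [hj] using h j
    · rintro ⟨h1, h2⟩ j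
      by_cases hj : j = i
      · subst hj; simpa using h2
      · simpa [hj] using h1 j
  rw [e, Measure.prod_prod, Measure.pi_pi, ← Finset.mul_prod_erase _ _ (Finset.mem_univ i),
    ← Finset.mul_prod_erase _ _ (Finset.mem_univ i)]
  simp only [Function.update_self, measure_univ, one_mul]
  rw [mul_comm]
  congr 1
  refine Finset.prod_congr rfl fun j hj => ?_
  rw [Function.update_of_ne (Finset.ne_of_mem_erase hj)]

lemma integrable_add_sum_abs_pow_gaussianPi (v : ℝ≥0) (n : ℕ) :
    Integrable (fun x : ι → ℝ => (3 + ∑ i, |x i|) ^ n) (gaussianPi ι v) := by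
  have h1 : Integrable (fun x : ι → ℝ => ∏ i, Real.exp (1 * |x i|)) (gaussianPi ι v) :=
    Integrable.fintype_prod (f := fun _ t => Real.exp (1 * |t|)) fun i =>
      integrable_exp_mul_abs (X := fun t => t) (integrable_exp_mul_gaussianReal 1)
        (integrable_exp_mul_gaussianReal (-1))
  refine Integrable.mono' (h1.const_mul (n.factorial * Real.exp 3)) ?_ (ae_of_all _ fun x => ?_)
  · exact (by fun_prop : Measurable fun x : ι → ℝ => (3 + ∑ i, |x i|) ^ n).aestronglyMeasurable
  · have h0 : 0 ≤ 3 + ∑ i, |x i| := by positivity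
    rw [Real.norm_of_nonneg (by positivity), ← Real.exp_sum, mul_assoc, ← Real.exp_add]
    have := Real.pow_div_factorial_le_exp _ h0 n
    rw [div_le_iff₀ (by positivity)] at this
    simpa [mul_comm] using this

namespace SuperlinearWeight

/-- The variance of a coordinate in the tilted measure. -/
def tiltVar (ν : Measure (ι → ℝ)) (W : (ι → ℝ) → ℝ) (i : ι) (x : ι → ℝ) : ℝ :=
  (∫ φ, φ i ^ 2 ∂(ν.tilted (linTilt W x))) - (∫ φ, φ i ∂(ν.tilted (linTilt W x))) ^ 2

/-- The mean of a coordinate in the tilted measure. -/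
def tiltMean (ν : Measure (ι → ℝ)) (W : (ι → ℝ) → ℝ) (i : ι) (x : ι → ℝ) : ℝ :=
  ∫ φ, φ i ∂(ν.tilted (linTilt W x))

variable {ν : Measure (ι → ℝ)} {W : (ι → ℝ) → ℝ} {C : ℝ} {m : ℕ}

lemma tiltVar_eq_variance (h : SuperlinearWeight ν W C m) (i : ι) (x : ι → ℝ) :
    tiltVar ν W i x = Var[fun φ => φ i; ν.tilted (linTilt W x)] := by
  have := h.isProbabilityMeasure x
  rw [variance_eq_sub (h.memLp_two x i)]
  rfl

/-- Moving the field at `i` tilts a fixed measure by `t * φ i`. The mean and the variance are then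
the first and second derivatives of one cumulant generating function, finite for every `t`. -/
lemma hasDerivAt_tiltMean [DecidableEq ι] (h : SuperlinearWeight ν W C m) (i : ι) (x : ι → ℝ)
    (t : ℝ) : HasDerivAt (fun t => tiltMean ν W i (Function.update x i t))
      (tiltVar ν W i (Function.update x i t)) t := by
  set μ := ν.tilted (linTilt W (Function.update x i 0)) with hμ
  set X : (ι → ℝ) → ℝ := fun φ => φ i
  have hlin : ∀ t, (linTilt W (Function.update x i 0) + fun φ => t * X φ) =
      linTilt W (Function.update x i t) := by
    intro t
    ext φ
    simp only [Pi.add_apply, linTilt, X, add_assoc]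
    congr 1
    rw [← Finset.add_sum_erase _ _ (Finset.mem_univ i),
      ← Finset.add_sum_erase (a := i) (s := Finset.univ)
        (fun j => Function.update x i t j * φ j) (Finset.mem_univ i)]
    simp only [Function.update_self, zero_mul, zero_add]
    rw [add_comm]
    congr 1
    refine Finset.sum_congr rfl fun j hj => ?_
    rw [Function.update_of_ne (Finset.ne_of_mem_erase hj),
      Function.update_of_ne (Finset.ne_of_mem_erase hj)]
  have htilt : ∀ t, μ.tilted (fun φ => t * X φ) = ν.tilted (linTilt W (Function.update x i t)) := by
    intro t
    rw [hμ, tilted_tilted (h.integrable_exp_linTilt _), hlin]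
  have huniv : integrableExpSet X μ = Set.univ := by
    refine Set.eq_univ_of_forall fun t => ?_
    change Integrable (fun φ => Real.exp (t * X φ)) μ
    rw [hμ, integrable_tilted_iff (h.integrable_exp_linTilt _)]
    refine (h.integrable_exp_linTilt (Function.update x i t)).congr (ae_of_all _ fun φ => ?_)
    simp only [smul_eq_mul, ← Real.exp_add, ← hlin t, Pi.add_apply]
  have hint : ∀ t, t ∈ interior (integrableExpSet X μ) := by simp [huniv]
  have hmean : (fun t => tiltMean ν W i (Function.update x i t)) = deriv (cgf X μ) := by
    ext t
    rw [← integral_tilted_mul_self (hint t), htilt t]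
    rfl
  rw [hmean, h.tiltVar_eq_variance, ← htilt t, variance_tilted_mul (hint t), iteratedDeriv_succ,
    iteratedDeriv_one]
  exact (analyticAt_cgf (hint t)).deriv.differentiableAt.hasDerivAt

lemma tiltVar_nonneg (h : SuperlinearWeight ν W C m) (i : ι) (x : ι → ℝ) :
    0 ≤ tiltVar ν W i x := by
  rw [h.tiltVar_eq_variance]; exact variance_nonneg _ _

lemma integrable_momentBound (v : ℝ≥0) : Integrable (momentBound ν C m) (gaussianPi ι v) :=
  (integrable_add_sum_abs_pow_gaussianPi v _).const_mul _

variable [SFinite ν]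

lemma stronglyMeasurable_tiltMean (h : SuperlinearWeight ν W C m) (i : ι) :
    StronglyMeasurable (tiltMean ν W i) :=
  h.stronglyMeasurable_integral_tilted (measurable_pi_apply i)

lemma stronglyMeasurable_tiltVar (h : SuperlinearWeight ν W C m) (i : ι) :
    StronglyMeasurable (tiltVar ν W i) :=
  (h.stronglyMeasurable_integral_tilted ((measurable_pi_apply i).pow_const 2)).sub
    ((h.stronglyMeasurable_tiltMean i).pow 2)

lemma integrable_tiltVar (h : SuperlinearWeight ν W C m) (v : ℝ≥0) (i : ι) :
    Integrable (tiltVar ν W i) (gaussianPi ι v) := by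
  refine Integrable.mono' (integrable_momentBound (ν := ν) (C := C) (m := m) v)
    (h.stronglyMeasurable_tiltVar i).aestronglyMeasurable (ae_of_all _ fun x => ?_)
  rw [Real.norm_of_nonneg (h.tiltVar_nonneg i x)]
  exact (sub_le_self _ (sq_nonneg _)).trans (h.integral_sq_le x i)

lemma integrable_tiltMean (h : SuperlinearWeight ν W C m) (v : ℝ≥0) (i : ι) :
    Integrable (tiltMean ν W i) (gaussianPi ι v) :=
  Integrable.mono' ((integrable_const 1).add (integrable_momentBound (ν := ν) (C := C) (m := m) v))
    (h.stronglyMeasurable_tiltMean i).aestronglyMeasurable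
    (ae_of_all _ fun x => h.abs_integral_le x i)

lemma integrable_mul_tiltMean (h : SuperlinearWeight ν W C m) (v : ℝ≥0) (i : ι) :
    Integrable (fun x => x i * tiltMean ν W i x) (gaussianPi ι v) := by
  refine Integrable.mono' (g := fun x => (3 + ∑ i, |x i|) ^ 1 +
    2 * (2 + (∫ φ, Real.exp (-∑ i, |φ i|) ∂ν) + 2 * C) ^ 2 *
      (3 + ∑ i, |x i|) ^ (2 * (m + 1) + 1)) ?_
    ((measurable_pi_apply i).stronglyMeasurable.mul
      (h.stronglyMeasurable_tiltMean i)).aestronglyMeasurable (ae_of_all _ fun x => ?_)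
  · exact (integrable_add_sum_abs_pow_gaussianPi v _).add
      ((integrable_add_sum_abs_pow_gaussianPi v _).const_mul _)
  · rw [norm_mul]
    have h1 : ‖x i‖ ≤ 3 + ∑ i, |x i| := by
      have := Finset.single_le_sum (f := fun j => |x j|) (fun j _ => abs_nonneg _)
        (Finset.mem_univ i)
      rw [Real.norm_eq_abs]
      linarith
    calc ‖x i‖ * ‖tiltMean ν W i x‖ ≤ (3 + ∑ i, |x i|) * (1 + momentBound ν C m x) :=
          mul_le_mul h1 (h.abs_integral_le x i) (norm_nonneg _) (by positivity)
      _ = _ := by unfold momentBound; ring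

/-- Gaussian integration by parts: the overlap of a coordinate with its field is its variance. -/
lemma integral_mul_tiltMean (h : SuperlinearWeight ν W C m) {v : ℝ≥0} (hv : v ≠ 0) (i : ι) :
    ∫ x, x i * tiltMean ν W i x ∂(gaussianPi ι v) = v * ∫ x, tiltVar ν W i x ∂(gaussianPi ι v) := by
  classical
  have hp := measurePreserving_update_pi (μ := fun _ : ι => gaussianReal 0 v) i
  -- Resampling the coordinate `i` preserves the law, so Fubini reduces the identity to
  -- one-dimensional integration by parts in the field at `i`.
  have fub : ∀ f : (ι → ℝ) → ℝ, Integrable f (gaussianPi ι v) →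
      ∫ x, f x ∂(gaussianPi ι v) =
        ∫ x, ∫ t, f (Function.update x i t) ∂(gaussianReal 0 v) ∂(gaussianPi ι v) := by
    intro f hf
    have hf' := (hp.integrable_comp hf.aestronglyMeasurable).2 hf
    calc ∫ x, f x ∂(gaussianPi ι v) = ∫ x, f x ∂(((gaussianPi ι v).prod (gaussianReal 0 v)).map
          fun p => Function.update p.1 i p.2) := by rw [hp.map_eq]
      _ = _ := by
        rw [integral_map hp.measurable.aemeasurable
          (by rw [hp.map_eq]; exact hf.aestronglyMeasurable)]
        exact integral_prod _ hf'
  have fubae : ∀ f : (ι → ℝ) → ℝ, Integrable f (gaussianPi ι v) →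
      ∀ᵐ x ∂(gaussianPi ι v), Integrable (fun t => f (Function.update x i t)) (gaussianReal 0 v) :=
    fun f hf => ((hp.integrable_comp hf.aestronglyMeasurable).2 hf).prod_right_ae
  rw [fub _ (h.integrable_mul_tiltMean v i), fub _ (h.integrable_tiltVar v i),
    ← integral_const_mul]
  refine integral_congr_ae ?_
  filter_upwards [fubae _ (h.integrable_mul_tiltMean v i), fubae _ (h.integrable_tiltVar v i),
    fubae _ (h.integrable_tiltMean v i)] with x h1 h2 h3
  simp only [Function.update_self] at h1 ⊢
  exact integral_id_mul_gaussianReal hv (h.hasDerivAt_tiltMean i x) h3 h1 h2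

end SuperlinearWeight

end GaussianFields

/-! ### Consequences of the hypotheses on the potential. -/

section Potential

variable {V : ℝ → ℝ}

/-- Midpoint concavity of `V x - x ^ 2 / 2`. The bound on the second derivative enters the proof
only in this form. -/
lemma add_sub_le_of_deriv2_le_one (hV : Differentiable ℝ V) (hV' : Differentiable ℝ (deriv V))
    (hV'' : ∀ t, deriv (deriv V) t ≤ 1) (a t : ℝ) :
    V (a + t) + V (a - t) ≤ 2 * V a + t ^ 2 := by
  have hd : deriv (fun x => V x - x ^ 2 / 2) = fun x => deriv V x - x := by
    ext x
    have h1 : HasDerivAt (fun x : ℝ => x ^ 2 / 2) x x := by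
      refine ((hasDerivAt_pow 2 x).div_const 2).congr_deriv ?_
      simp
    exact ((hV x).hasDerivAt.sub h1).deriv
  have hc : ConcaveOn ℝ Set.univ (fun x => V x - x ^ 2 / 2) := by
    refine concaveOn_univ_of_deriv2_nonpos (by fun_prop) (by rw [hd]; fun_prop) fun x => ?_
    rw [Function.iterate_succ, Function.iterate_one, Function.comp_apply, hd]
    have := ((hV' x).hasDerivAt.sub (hasDerivAt_id x)).deriv
    have e : deriv (fun x => deriv V x - x) x = deriv (deriv V) x - 1 := this
    rw [e]
    linarith [hV'' x]
  have := hc.2 (Set.mem_univ (a + t)) (Set.mem_univ (a - t)) (by norm_num : (0 : ℝ) ≤ 1 / 2)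
    (by norm_num : (0 : ℝ) ≤ 1 / 2) (by norm_num)
  simp only [smul_eq_mul] at this
  have e : 1 / 2 * (a + t) + 1 / 2 * (a - t) = a := by ring
  rw [e] at this
  nlinarith

/-- A potential growing like a power larger than one beats every linear function, at a polynomial
cost in the slope. -/
lemma exists_mul_abs_le_add (hV : Continuous V) (hVpos : ∀ᶠ t in cocompact ℝ, 0 < V t)
    (hVgrowth : 1 < liminf (fun t : ℝ => ((Real.log (V t) / Real.log |t| : ℝ) : EReal))
      (cocompact ℝ)) :
    ∃ C : ℝ, 0 ≤ C ∧ ∃ m : ℕ, ∀ K : ℝ, 0 ≤ K → ∀ t, K * |t| ≤ V t + C * (1 + K) ^ m := by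
  obtain ⟨p, hp1, hp2⟩ := EReal.lt_iff_exists_real_btwn.1 hVgrowth
  have hp : 1 < p := by exact_mod_cast hp1
  have hev := eventually_lt_of_lt_liminf hp2
  -- The growth exponent `p > 1` is lowered to `1 + 1 / (k + 1)`, so that the polynomial cost in the
  -- slope has the natural degree `k + 2`.
  obtain ⟨k, hk⟩ := exists_nat_one_div_lt (sub_pos.2 hp)
  have hev2 : ∀ᶠ t : ℝ in cocompact ℝ, 1 < |t| :=
    (tendsto_norm_cocompact_atTop (E := ℝ)).eventually_gt_atTop 1
  obtain ⟨R, hR⟩ : ∃ R : ℝ, ∀ t, R < |t| → |t| * |t| ^ ((1 : ℝ) / (k + 1)) ≤ V t := by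
    have h3 : ∀ᶠ t : ℝ in cocompact ℝ, |t| * |t| ^ ((1 : ℝ) / (k + 1)) ≤ V t := by
      filter_upwards [hVpos, hev, hev2] with t h1 h2 h3
      have hlog : 0 < Real.log |t| := Real.log_pos h3
      have h2' : p < Real.log (V t) / Real.log |t| := by exact_mod_cast h2
      rw [lt_div_iff₀ hlog] at h2'
      have h0 : 0 < |t| := by linarith
      calc |t| * |t| ^ ((1 : ℝ) / (k + 1)) = |t| ^ (1 + (1 : ℝ) / (k + 1)) := by
            rw [Real.rpow_add h0, Real.rpow_one]
        _ ≤ |t| ^ p := Real.rpow_le_rpow_of_exponent_le h3.le (by linarith)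
        _ ≤ V t := by
            rw [Real.rpow_def_of_pos h0]
            exact (Real.le_log_iff_exp_le h1).1 (by linarith)
    rw [← Metric.cobounded_eq_cocompact, ← comap_norm_atTop] at h3
    obtain ⟨R, hR⟩ := (eventually_comap.1 h3).exists_forall_of_atTop
    exact ⟨R, fun t ht => hR |t| ht.le t rfl⟩
  set R' := max R 0
  obtain ⟨t₀, -, ht₀⟩ := (isCompact_Icc (a := -R') (b := R')).exists_isMinOn
    ⟨0, by simp [R']⟩ hV.continuousOn
  refine ⟨1 + |V t₀| + R', by positivity, k + 2, fun K hK t => ?_⟩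
  have hpow1 : (1 : ℝ) ≤ (1 + K) ^ (k + 2) := one_le_pow₀ (by linarith)
  have hpowK : K ≤ (1 + K) ^ (k + 2) := by
    calc K ≤ (1 + K) ^ 1 := by rw [pow_one]; linarith
      _ ≤ _ := pow_le_pow_right₀ (by linarith) (by omega)
  have hR'0 : 0 ≤ R' := le_max_right _ _
  have hexp : (1 + |V t₀| + R') * (1 + K) ^ (k + 2) =
    (1 + K) ^ (k + 2) + |V t₀| * (1 + K) ^ (k + 2) + R' * (1 + K) ^ (k + 2) := by ring
  rw [hexp]
  have a1 : |V t₀| ≤ |V t₀| * (1 + K) ^ (k + 2) := le_mul_of_one_le_right (abs_nonneg _) hpow1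
  have a2 : R' * K ≤ R' * (1 + K) ^ (k + 2) := by gcongr
  have a3 : 0 ≤ R' * K := by positivity
  rcases le_or_gt |t| R' with ht | ht
  · have h1 : V t₀ ≤ V t := ht₀ (abs_le.1 ht)
    have h2 : K * |t| ≤ R' * K := by rw [mul_comm]; gcongr
    linarith [neg_abs_le (V t₀)]
  · have h1 := hR t ((le_max_left _ _).trans_lt ht)
    have h0 : 0 < |t| := hR'0.trans_lt ht
    have hr : 0 ≤ |t| * |t| ^ ((1 : ℝ) / (k + 1)) := by positivity
    -- Where `|t| ≥ K ^ (k + 1)`, the surplus factor `|t| ^ (1 / (k + 1))` already beats `K`;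
    -- otherwise `K * |t|` is at most `K ^ (k + 2)`.
    rcases le_or_gt (K ^ (k + 1)) |t| with h | h
    · have h2 : K ≤ |t| ^ ((1 : ℝ) / (k + 1)) := by
        have : (K ^ (k + 1)) ^ ((1 : ℝ) / (k + 1)) ≤ |t| ^ ((1 : ℝ) / (k + 1)) := by gcongr
        have e : (K ^ (k + 1)) ^ ((1 : ℝ) / (k + 1)) = K := by
          have := Real.pow_rpow_inv_natCast hK (Nat.succ_ne_zero k)
          simpa [one_div] using this
        rwa [e] at this
      have : K * |t| ≤ |t| * |t| ^ ((1 : ℝ) / (k + 1)) := by rw [mul_comm]; gcongr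
      linarith [abs_nonneg (V t₀)]
    · have : K * |t| ≤ (1 + K) ^ (k + 2) := by
        calc K * |t| ≤ K * K ^ (k + 1) := by gcongr
          _ = K ^ (k + 2) := by ring
          _ ≤ _ := by gcongr; linarith
      linarith [abs_nonneg (V t₀)]

end Potential

/-! ### The interaction energy: crude counting, horizontal bonds, second differences. -/

section Energy

/-- The total interaction energy, with zero boundary condition. -/
def energy {d : ℕ} (V : ℝ → ℝ) (Λ : Finset (Site d)) (φ : Λ → ℝ) : ℝ :=
  bulkEnergy V Λ φ + boundaryEnergy V Λ φ

/-- Extension of a configuration by zero. -/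
def zeroExtend {d : ℕ} (Λ : Finset (Site d)) (φ : Λ → ℝ) (j : Site d) : ℝ :=
  open Classical in if h : j ∈ Λ then φ ⟨j, h⟩ else 0

lemma zeroExtend_of_mem {d : ℕ} {Λ : Finset (Site d)} (φ : Λ → ℝ) {j : Site d} (h : j ∈ Λ) :
    zeroExtend Λ φ j = φ ⟨j, h⟩ := by simp [zeroExtend, h]

lemma zeroExtend_of_notMem {d : ℕ} {Λ : Finset (Site d)} (φ : Λ → ℝ) {j : Site d} (h : j ∉ Λ) :
    zeroExtend Λ φ j = 0 := by simp [zeroExtend, h]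

/-- The first unit vector. -/
def rowShift : Site 2 := Pi.single 0 1

lemma nearestNeighbour_add_rowShift (i : Site 2) : NearestNeighbour i (i + rowShift) := by
  simp [NearestNeighbour, rowShift]

lemma lt_add_rowShift (i : Site 2) : i < i + rowShift := by
  refine lt_add_of_pos_right i (Pi.lt_def.2 ⟨fun k => ?_, 0, ?_⟩)
  · by_cases hk : k = 0 <;> simp [rowShift, hk]
  · simp [rowShift]

lemma NearestNeighbour.mem_Icc {d : ℕ} {i j : Site d} (h : NearestNeighbour i j) :
    j ∈ Finset.Icc (i - 1) (i + 1) := by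
  have hk : ∀ k, |i k - j k| ≤ 1 := fun k => by
    rw [← (h : ∑ k, |i k - j k| = 1)]
    exact Finset.single_le_sum (f := fun k => |i k - j k|) (fun _ _ => abs_nonneg _)
      (Finset.mem_univ k)
  simp only [Finset.mem_Icc, Pi.le_def]
  refine ⟨fun k => ?_, fun k => ?_⟩ <;> have := abs_le.1 (hk k) <;> simp <;> linarith

lemma card_Icc_sub_one_add_one (i : Site 2) : (Finset.Icc (i - 1) (i + 1)).card = 9 := by
  rw [Pi.card_Icc]
  have : ∀ k, (Finset.Icc ((i - 1) k) ((i + 1) k)).card = 3 := fun k => by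
    rw [Int.card_Icc]; simp; ring_nf; rfl
  rw [Finset.prod_congr rfl fun k _ => this k]; simp

open Classical in
lemma sum_bond_le (Λ : Finset (Site 2)) (i : Λ) {M : ℝ} (hM : 0 ≤ M) {F : Λ → ℝ}
    (hF : ∀ j : Λ, NearestNeighbour (i : Site 2) j → F j ≤ M) :
    (∑ j : Λ, if NearestNeighbour (i : Site 2) (j : Site 2) ∧ (i : Site 2) < (j : Site 2)
      then F j else 0) ≤ 9 * M := by
  calc _ ≤ ∑ j : Λ, if (j : Site 2) ∈ Finset.Icc ((i : Site 2) - 1) (i + 1) then M else 0 := by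
        refine Finset.sum_le_sum fun j _ => ?_
        by_cases h : NearestNeighbour (i : Site 2) (j : Site 2) ∧ (i : Site 2) < (j : Site 2)
        · rw [if_pos h, if_pos h.1.mem_Icc]; exact hF j h.1
        · rw [if_neg h]; split_ifs <;> simp [hM]
    _ = ∑ j ∈ Λ, if j ∈ Finset.Icc ((i : Site 2) - 1) (i + 1) then M else 0 :=
        Finset.sum_coe_sort Λ fun j => if j ∈ Finset.Icc ((i : Site 2) - 1) (i + 1) then M else 0
    _ ≤ 9 * M := by
        rw [← Finset.sum_filter, Finset.sum_const, nsmul_eq_mul]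
        gcongr
        calc _ ≤ ((Finset.Icc ((i : Site 2) - 1) (i + 1)).card : ℝ) := by
              gcongr; intro j; simp
          _ = 9 := by rw [card_Icc_sub_one_add_one]; norm_num

open Classical in
lemma sum_boundary_le (Λ : Finset (Site 2)) (i : Site 2) {M c : ℝ} (hM : 0 ≤ M) (hc : c ≤ M) :
    ∑ _j ∈ (Finset.Icc (i - 1) (i + 1)).filter (fun j => j ∉ Λ ∧ NearestNeighbour i j), c ≤
      9 * M := by
  rw [Finset.sum_const, nsmul_eq_mul]
  have : ((((Finset.Icc (i - 1) (i + 1)).filter (fun j => j ∉ Λ ∧ NearestNeighbour i j)).card : ℕ)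
      : ℝ) ≤ 9 := by
    have := Finset.card_filter_le (Finset.Icc (i - 1) (i + 1))
      (fun j => j ∉ Λ ∧ NearestNeighbour i j)
    rw [card_Icc_sub_one_add_one] at this
    exact_mod_cast this
  calc _ ≤ _ * M := mul_le_mul_of_nonneg_left hc (Nat.cast_nonneg _)
    _ ≤ 9 * M := by gcongr

/-- The neighbours of a site lie in a `3 × 3` square. Counting all `9` points once for the bulk and
once for the boundary gives `18`. -/
lemma energy_le_of_le (V : ℝ → ℝ) (Λ : Finset (Site 2)) (φ : Λ → ℝ) {M : ℝ} (hM : 0 ≤ M)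
    (h1 : ∀ i j, V (φ i - φ j) ≤ M) (h2 : ∀ i, V (φ i) ≤ M) :
    energy V Λ φ ≤ 18 * M * Λ.card := by
  have b1 : bulkEnergy V Λ φ ≤ ∑ _i : Λ, 9 * M :=
    Finset.sum_le_sum fun i _ => sum_bond_le Λ i hM fun j _ => h1 i j
  have b2 : boundaryEnergy V Λ φ ≤ ∑ _i : Λ, 9 * M :=
    Finset.sum_le_sum fun i _ => sum_boundary_le Λ i hM (h2 i)
  simp only [Finset.sum_const, Finset.card_univ, Fintype.card_coe, nsmul_eq_mul] at b1 b2
  unfold energy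
  linarith

lemma energy_add_const {d : ℕ} (V : ℝ → ℝ) (c : ℝ) (Λ : Finset (Site d)) (φ : Λ → ℝ) :
    energy (fun t => V t + c) Λ φ = energy V Λ φ + energy (fun _ => c) Λ φ := by
  have h1 : bulkEnergy (fun t => V t + c) Λ φ = bulkEnergy V Λ φ + bulkEnergy (fun _ => c) Λ φ := by
    unfold bulkEnergy
    simp_rw [← Finset.sum_add_distrib]
    refine Finset.sum_congr rfl fun i _ => Finset.sum_congr rfl fun j _ => ?_
    split_ifs <;> simp
  have h2 : boundaryEnergy (fun t => V t + c) Λ φ =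
      boundaryEnergy V Λ φ + boundaryEnergy (fun _ => c) Λ φ := by
    unfold boundaryEnergy
    simp_rw [← Finset.sum_add_distrib]
  unfold energy
  rw [h1, h2]; ring

/-- The energy dominates the sum over the horizontal bonds. -/
lemma sum_row_le_energy {U : ℝ → ℝ} (hU : ∀ t, 0 ≤ U t) (Λ : Finset (Site 2)) (φ : Λ → ℝ) :
    ∑ i : Λ, U (φ i - zeroExtend Λ φ (i + rowShift)) ≤ energy U Λ φ := by
  classical
  unfold energy bulkEnergy boundaryEnergy
  rw [← Finset.sum_add_distrib]
  refine Finset.sum_le_sum fun i _ => ?_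
  have hn1 : 0 ≤ ∑ j : Λ, if NearestNeighbour (i : Site 2) (j : Site 2) ∧
      (i : Site 2) < (j : Site 2) then U (φ i - φ j) else 0 :=
    Finset.sum_nonneg fun j _ => by split_ifs <;> simp [hU]
  have hn2 : 0 ≤ ∑ _j ∈ (Finset.Icc ((i : Site 2) - 1) ((i : Site 2) + 1)).filter
    (fun j => j ∉ Λ ∧ NearestNeighbour (i : Site 2) j), U (φ i) :=
    Finset.sum_nonneg fun j _ => hU _
  by_cases h : (i : Site 2) + rowShift ∈ Λ
  · rw [zeroExtend_of_mem φ h]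
    have := Finset.single_le_sum (f := fun j : Λ => if NearestNeighbour (i : Site 2) (j : Site 2) ∧
      (i : Site 2) < (j : Site 2) then U (φ i - φ j) else 0)
      (fun j _ => by split_ifs <;> simp [hU]) (Finset.mem_univ ⟨_, h⟩)
    rw [if_pos ⟨nearestNeighbour_add_rowShift _, lt_add_rowShift _⟩] at this
    convert (le_add_of_le_of_nonneg this hn2) using 1
  · rw [zeroExtend_of_notMem φ h, sub_zero]
    have := Finset.single_le_sum (f := fun _ : Site 2 => U (φ i)) (s :=
      (Finset.Icc ((i : Site 2) - 1) ((i : Site 2) + 1)).filter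
        (fun j => j ∉ Λ ∧ NearestNeighbour (i : Site 2) j)) (fun j _ => hU _)
      (a := (i : Site 2) + rowShift) (by
        rw [Finset.mem_filter]
        exact ⟨(nearestNeighbour_add_rowShift _).mem_Icc, h, nearestNeighbour_add_rowShift _⟩)
    convert (le_add_of_nonneg_of_le hn1 this) using 1

/-- The energy is a sum of `V` over linear expressions in `φ`, so the second-difference bound is
applied bond by bond. -/
lemma energy_add_sub_le {V : ℝ → ℝ} (hV : ∀ a t, V (a + t) + V (a - t) ≤ 2 * V a + t ^ 2)
    {d : ℕ} (Λ : Finset (Site d)) (φ h : Λ → ℝ) :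
    energy V Λ (φ + h) + energy V Λ (φ - h) ≤ 2 * energy V Λ φ + energy (fun t => t ^ 2) Λ h := by
  have b1 : bulkEnergy V Λ (φ + h) + bulkEnergy V Λ (φ - h) ≤
      2 * bulkEnergy V Λ φ + bulkEnergy (fun t => t ^ 2) Λ h := by
    unfold bulkEnergy
    simp_rw [Finset.mul_sum, ← Finset.sum_add_distrib]
    refine Finset.sum_le_sum fun i _ => Finset.sum_le_sum fun j _ => ?_
    split_ifs
    · convert hV (φ i - φ j) (h i - h j) using 2 <;> congr 1 <;> simp only [Pi.add_apply, Pi.sub_apply] <;> ring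
    · simp
  have b2 : boundaryEnergy V Λ (φ + h) + boundaryEnergy V Λ (φ - h) ≤
      2 * boundaryEnergy V Λ φ + boundaryEnergy (fun t => t ^ 2) Λ h := by
    unfold boundaryEnergy
    simp_rw [Finset.mul_sum, ← Finset.sum_add_distrib]
    exact Finset.sum_le_sum fun i _ => Finset.sum_le_sum fun j _ => hV (φ i) (h i)
  unfold energy
  linarith

lemma continuous_energy {V : ℝ → ℝ} (hV : Continuous V) {d : ℕ} (Λ : Finset (Site d)) :
    Continuous (energy V Λ) := by
  unfold energy bulkEnergy boundaryEnergy
  refine Continuous.add ?_ ?_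
  · refine continuous_finsetSum _ fun i _ => continuous_finsetSum _ fun j _ => ?_
    split_ifs
    · fun_prop
    · fun_prop
  · fun_prop

end Energy

/-! ### Integrating a triangular product one coordinate at a time. -/

section Peeling

variable {ι : Type*} [Fintype ι] [DecidableEq ι] {μ : ι → Measure ℝ} [∀ i, SigmaFinite (μ i)]

/-- If the factor `g i` depends only on the coordinate `i` and on coordinates with a larger key, and
its integral over the coordinate `i` is at most `D`, then the integral of the product of all factors
is at most `D ^ card ι`. -/
lemma lintegral_prod_le_pow (g : ι → (ι → ℝ) → ℝ≥0∞) (hg : ∀ i, Measurable (g i)) (key : ι → ℤ)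
    (hdep : ∀ i φ ψ, φ i = ψ i → (∀ j, key i < key j → φ j = ψ j) → g i φ = g i ψ)
    {D : ℝ≥0∞} (hD : ∀ i (φ : ι → ℝ),
      ∫⁻ t, g i (Function.update φ i t) ∂(μ i) ≤ D) :
    ∫⁻ φ, ∏ i, g i φ ∂(Measure.pi μ) ≤ D ^ Fintype.card ι := by
  have hgm : ∀ s : Finset ι, Measurable fun φ => ∏ i ∈ s, g i φ := fun s =>
    Finset.measurable_prod s fun i _ => hg i
  have main : ∀ s : Finset ι, ∀ φ, lmarginal μ s (fun φ => ∏ i ∈ s, g i φ) φ ≤ D ^ s.card := by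
    intro s
    -- The new index `a` has maximal key, so `g a` involves no coordinate in `s` and leaves the
    -- inner integral. Ties are harmless, since dependence is only on strictly larger keys.
    induction s using Finset.induction_on_max_value key with
    | empty => intro φ; simp
    | insert a s ha hmax ih =>
      intro φ
      rw [lmarginal_insert _ (hgm _) ha, Finset.card_insert_of_notMem ha, pow_succ']
      have inner : ∀ ψ, lmarginal μ s (fun φ => ∏ i ∈ insert a s, g i φ) ψ ≤
          g a ψ * D ^ s.card := by
        intro ψ
        have e : ∀ y : s → ℝ, g a (Function.updateFinset ψ s y) = g a ψ := by
          intro y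
          refine hdep a _ _ ?_ fun j hj => ?_
          · simp [Function.updateFinset, ha]
          · have : j ∉ s := fun hjs => absurd (hmax j hjs) (not_le.2 hj)
            simp [Function.updateFinset, this]
        calc lmarginal μ s (fun φ => ∏ i ∈ insert a s, g i φ) ψ
            = g a ψ * lmarginal μ s (fun φ => ∏ i ∈ s, g i φ) ψ := by
              unfold lmarginal
              simp_rw [Finset.prod_insert ha, e]
              rw [lintegral_const_mul]
              exact (hgm s).comp measurable_updateFinset
          _ ≤ _ := by gcongr; exact ih ψ
      calc _ ≤ ∫⁻ t, g a (Function.update φ a t) * D ^ s.card ∂(μ a) :=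
            lintegral_mono fun t => inner _
        _ = (∫⁻ t, g a (Function.update φ a t) ∂(μ a)) * D ^ s.card :=
            lintegral_mul_const _ ((hg a).comp (measurable_update φ))
        _ ≤ D * D ^ s.card := by gcongr; exact hD a φ
  rw [lintegral_eq_lmarginal_univ 0]
  exact main Finset.univ 0

end Peeling

/-! ### The pinning reference measure. -/

section Pinning

lemma restrict_pinning (ε : ℝ≥0) :
    ((volume : Measure ℝ) + ε • Measure.dirac (0 : ℝ)).restrict {0}ᶜ = volume := by
  rw [Measure.restrict_add, Measure.restrict_smul,
    Measure.restrict_eq_zero.2 (by simp : Measure.dirac (0 : ℝ) {0}ᶜ = 0), smul_zero, add_zero]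
  exact Measure.restrict_eq_self_of_ae_mem (by simp [ae_iff])

lemma pinningMeasure_zero {d : ℕ} (Λ : Finset (Site d)) : pinningMeasure 0 Λ = volume := by
  simp [pinningMeasure, volume_pi]

/-- Removing the configurations with some coordinate equal to zero kills every atom and loses no
Lebesgue mass, so Lebesgue measure is a restriction of the pinning measure. -/
lemma volume_le_pinningMeasure {d : ℕ} (ε : ℝ≥0) (Λ : Finset (Site d)) :
    (volume : Measure (Λ → ℝ)) ≤ pinningMeasure ε Λ := by
  have : (volume : Measure (Λ → ℝ)) = (pinningMeasure ε Λ).restrict (Set.univ.pi fun _ => {0}ᶜ) := by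
    rw [pinningMeasure, Measure.restrict_pi_pi, restrict_pinning, volume_pi]
  rw [this]
  exact Measure.restrict_le_self

instance sigmaFinite_pinningMeasure {d : ℕ} (ε : ℝ≥0) (Λ : Finset (Site d)) :
    SigmaFinite (pinningMeasure ε Λ) := by
  unfold pinningMeasure; infer_instance

lemma integrable_exp_neg_abs : Integrable fun t : ℝ => Real.exp (-|t|) := by
  refine Integrable.mono' (integrable_inv_one_add_sq.const_mul 2) (by fun_prop)
    (ae_of_all _ fun t => ?_)
  have h := Real.quadratic_le_exp_of_nonneg (abs_nonneg t)
  rw [sq_abs] at h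
  rw [Real.norm_of_nonneg (Real.exp_pos _).le, Real.exp_neg, ← div_eq_mul_inv,
    inv_eq_one_div, div_le_div_iff₀ (Real.exp_pos _) (by positivity)]
  nlinarith [abs_nonneg t]

lemma integrable_exp_neg_sum_abs {d : ℕ} (ε : ℝ≥0) (Λ : Finset (Site d)) :
    Integrable (fun φ : Λ → ℝ => Real.exp (-∑ i, |φ i|)) (pinningMeasure ε Λ) := by
  have h : Integrable (fun t : ℝ => Real.exp (-|t|))
      ((volume : Measure ℝ) + ε • Measure.dirac (0 : ℝ)) :=
    integrable_exp_neg_abs.add_measure ((integrable_dirac (by simp)).smul_measure_nnreal)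
  have := Integrable.fintype_prod (ι := Λ) (f := fun _ t => Real.exp (-|t|)) fun _ => h
  simp only [← Real.exp_sum, Finset.sum_neg_distrib] at this
  exact this

end Pinning

/-! ### Growth of the Gibbs weight, lower bounds on partition functions, and the shift argument. -/

section GibbsWeight

/-- The exponent of the Gibbs density without external field, in dimension two. -/
def gibbsWeight (V : ℝ → ℝ) (Λ : Finset (Site 2)) (φ : Λ → ℝ) : ℝ := -(1 / 8) * energy V Λ φ

lemma gibbsExponent_eq_linTilt (V : ℝ → ℝ) (Λ : Finset (Site 2)) (η : Site 2 → ℝ) :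
    gibbsExponent V Λ η = linTilt (gibbsWeight V Λ) (fun i : Λ => η i) := by
  ext φ
  simp only [gibbsExponent, linTilt, gibbsWeight, energy]
  push_cast
  ring

lemma measurable_gibbsWeight {V : ℝ → ℝ} (hV : Continuous V) (Λ : Finset (Site 2)) :
    Measurable (gibbsWeight V Λ) := by
  have := (continuous_energy hV Λ).measurable
  unfold gibbsWeight
  fun_prop

lemma rowShift_zero : rowShift 0 = 1 := by simp [rowShift]

lemma mem_box {d L : ℕ} {i : Site d} : i ∈ box d L ↔ ∀ k, |i k| ≤ L := by
  simp [box, Pi.le_def, abs_le, forall_and]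

/-- After `n` steps to the right the walk has left the box, where the extension vanishes;
telescoping bounds the height, each increment being at most the full sum. -/
lemma abs_zeroExtend_le (L : ℕ) (φ : box 2 L → ℝ) (n : ℕ) (i : Site 2) (hi : (L : ℤ) < i 0 + n) :
    |zeroExtend (box 2 L) φ i| ≤
      n * ∑ j : box 2 L, |φ j - zeroExtend (box 2 L) φ (j + rowShift)| := by
  set T := ∑ j : box 2 L, |φ j - zeroExtend (box 2 L) φ (j + rowShift)| with hT
  have hT0 : 0 ≤ T := Finset.sum_nonneg fun _ _ => abs_nonneg _
  induction n generalizing i with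
  | zero =>
    have : i ∉ box 2 L := fun h => by
      have := (abs_le.1 (mem_box.1 h 0)).2
      simp at hi; omega
    simp [zeroExtend_of_notMem φ this]
  | succ n ih =>
    by_cases h : i ∈ box 2 L
    · have h1 := ih (i + rowShift) (by
        rw [Pi.add_apply, rowShift_zero]; push_cast at hi; omega)
      have h2 : |zeroExtend (box 2 L) φ i - zeroExtend (box 2 L) φ (i + rowShift)| ≤ T := by
        rw [zeroExtend_of_mem φ h]
        exact Finset.single_le_sum
          (f := fun j : box 2 L => |φ j - zeroExtend (box 2 L) φ (j + rowShift)|)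
          (fun _ _ => abs_nonneg _) (Finset.mem_univ (⟨i, h⟩ : box 2 L))
      have h3 := abs_sub_abs_le_abs_sub (zeroExtend (box 2 L) φ i)
        (zeroExtend (box 2 L) φ (i + rowShift))
      push_cast
      linarith
    · rw [zeroExtend_of_notMem φ h]; simp; positivity

lemma sum_abs_le_mul_row_sum (L : ℕ) (φ : box 2 L → ℝ) :
    ∑ i, |φ i| ≤ ((box 2 L).card * (2 * L + 1)) *
      ∑ j : box 2 L, |φ j - zeroExtend (box 2 L) φ (j + rowShift)| := by
  set T := ∑ j : box 2 L, |φ j - zeroExtend (box 2 L) φ (j + rowShift)| with hT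
  have h : ∀ i : box 2 L, |φ i| ≤ (2 * L + 1) * T := fun i => by
    have := abs_zeroExtend_le L φ (2 * L + 1) i (by
      have := (abs_le.1 (mem_box.1 i.2 0)).1
      push_cast; omega)
    rw [zeroExtend_of_mem φ i.2] at this
    exact_mod_cast this
  calc _ ≤ ∑ _i : box 2 L, (2 * L + 1) * T := Finset.sum_le_sum fun i _ => h i
    _ = _ := by simp [mul_assoc]

variable {V : ℝ → ℝ} {C : ℝ} {m : ℕ}

/-- Discarding the other bonds requires a nonnegative potential. Adding `C` to every bond ensures
this and costs at most `18 * C` per site. -/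
lemma sum_row_sub_le_energy (hC : 0 ≤ C) (hU : ∀ t, 0 ≤ V t + C) (Λ : Finset (Site 2))
    (φ : Λ → ℝ) :
    ∑ i : Λ, (V (φ i - zeroExtend Λ φ (i + rowShift)) + C) - 18 * C * Λ.card ≤ energy V Λ φ := by
  have h1 := sum_row_le_energy hU Λ φ
  have h2 := energy_add_const V C Λ φ
  have h3 := energy_le_of_le (fun _ => C) Λ φ hC (fun _ _ => le_rfl) (fun _ => le_rfl)
  linarith

/-- The Gibbs weight decays faster than every exponential. -/
lemma exists_gibbsWeight_le (hC : 0 ≤ C)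
    (h : ∀ K : ℝ, 0 ≤ K → ∀ t, K * |t| ≤ V t + C * (1 + K) ^ m) (L : ℕ) :
    ∃ C' : ℝ, 0 ≤ C' ∧ ∀ s, 0 ≤ s → ∀ φ,
      gibbsWeight V (box 2 L) φ ≤ -s * ∑ i, |φ i| + C' * (1 + s) ^ m := by
  have hU : ∀ t, 0 ≤ V t + C := fun t => by simpa using h 0 le_rfl t
  obtain ⟨n, hn⟩ : ∃ n : ℝ, n = (box 2 L).card := ⟨_, rfl⟩
  have hn0 : 0 ≤ n := hn ▸ Nat.cast_nonneg _
  obtain ⟨N, hN⟩ : ∃ N : ℝ, N = n * (2 * L + 1) := ⟨_, rfl⟩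
  have hN0 : 0 ≤ N := by rw [hN]; positivity
  refine ⟨n * C * ((1 + 8 * N) ^ m + 18), by positivity, fun s hs φ => ?_⟩
  have h1 := sum_row_sub_le_energy hC hU (box 2 L) φ
  have h2 := sum_abs_le_mul_row_sum L φ
  -- The slope `8 * N * s` compensates the prefactor `1 / 8` and the factor `N` lost in passing from
  -- heights to horizontal gradients.
  have h3 : 8 * N * s * (∑ j : box 2 L, |φ j - zeroExtend (box 2 L) φ (j + rowShift)|) -
      n * (C * (1 + 8 * N * s) ^ m) ≤
      ∑ i : box 2 L, (V (φ i - zeroExtend (box 2 L) φ (i + rowShift)) + C) := by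
    have : ∑ i : box 2 L, (8 * N * s * |φ i - zeroExtend (box 2 L) φ (i + rowShift)| -
        C * (1 + 8 * N * s) ^ m) ≤
        ∑ i : box 2 L, (V (φ i - zeroExtend (box 2 L) φ (i + rowShift)) + C) :=
      Finset.sum_le_sum fun i _ => by
        have := h (8 * N * s) (by positivity) (φ i - zeroExtend (box 2 L) φ (i + rowShift))
        linarith
    rw [Finset.sum_sub_distrib, ← Finset.mul_sum, Finset.sum_const, Finset.card_univ,
      Fintype.card_coe, nsmul_eq_mul, ← hn] at this
    exact this
  rw [← hn, ← hN] at h2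
  rw [← hn] at h1
  generalize (∑ j : box 2 L, |φ j - zeroExtend (box 2 L) φ (j + rowShift)|) = T at h2 h3
  generalize (∑ i : box 2 L, (V (φ i - zeroExtend (box 2 L) φ (i + rowShift)) + C)) = R at h1 h3
  unfold gibbsWeight
  generalize (∑ i, |φ i|) = S at h2 ⊢
  generalize energy V (box 2 L) φ = E at h1 ⊢
  have h4 : (1 + 8 * N * s) ^ m ≤ (1 + 8 * N) ^ m * (1 + s) ^ m := by
    rw [← mul_pow]
    gcongr
    nlinarith
  have h5 : (1 : ℝ) ≤ (1 + s) ^ m := one_le_pow₀ (by linarith)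
  have h6 : s * S ≤ s * (N * T) := by gcongr
  have h7 : n * C * (1 + 8 * N * s) ^ m ≤ n * C * ((1 + 8 * N) ^ m * (1 + s) ^ m) := by gcongr
  have h8 : n * C * 18 * 1 ≤ n * C * 18 * (1 + s) ^ m := by gcongr
  have h9 : 0 ≤ n * C * (1 + 8 * N * s) ^ m := by positivity
  have h10 : 0 ≤ n * C * 18 := by positivity
  have e : n * C * ((1 + 8 * N) ^ m + 18) * (1 + s) ^ m =
    n * C * ((1 + 8 * N) ^ m * (1 + s) ^ m) + n * C * 18 * (1 + s) ^ m := by ring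
  rw [e]
  linarith

lemma neg_le_gibbsWeight {M : ℝ} (hM : 0 ≤ M) (hVM : ∀ t, |t| ≤ 1 → V t ≤ M)
    (Λ : Finset (Site 2)) {φ : Λ → ℝ} (hφ : ∀ i, φ i ∈ Set.Icc (0 : ℝ) 1) :
    -(9 / 4 * M * Λ.card) ≤ gibbsWeight V Λ φ := by
  have := energy_le_of_le V Λ φ hM
    (fun i j => hVM _ (abs_le.2 ⟨by linarith [(hφ i).1, (hφ j).2], by linarith [(hφ i).2, (hφ j).1]⟩))
    (fun i => hVM _ (abs_le.2 ⟨by linarith [(hφ i).1], (hφ i).2⟩))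
  unfold gibbsWeight
  linarith

/-- Only heights in `[0, 1]` are kept. There all gradients lie in `[-1, 1]`, and this cube has
reference mass `(1 + ε) ^ |Λ| ≥ 1`, so the bound does not involve `ε`. -/
lemma exp_le_partitionFn {M : ℝ} (hM : 0 ≤ M) (hVM : ∀ t, |t| ≤ 1 → V t ≤ M)
    (Λ : Finset (Site 2)) (ε : ℝ≥0) (x : Λ → ℝ)
    (hi : Integrable (fun φ => Real.exp (linTilt (gibbsWeight V Λ) x φ)) (pinningMeasure ε Λ)) :
    Real.exp (-(9 / 4 * M * Λ.card) - ∑ i, |x i|) ≤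
      partitionFn (pinningMeasure ε Λ) (gibbsWeight V Λ) x := by
  set c := Real.exp (-(9 / 4 * M * Λ.card) - ∑ i, |x i|) with hc
  set S : Set (Λ → ℝ) := Set.univ.pi fun _ => Set.Icc 0 1 with hS
  have hSm : MeasurableSet S := MeasurableSet.univ_pi fun _ => measurableSet_Icc
  have hbound : ∀ φ ∈ S, c ≤ Real.exp (linTilt (gibbsWeight V Λ) x φ) := by
    intro φ hφ
    have hφ' : ∀ i, φ i ∈ Set.Icc (0 : ℝ) 1 := fun i => hφ i (Set.mem_univ i)
    apply Real.exp_le_exp.2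
    have h1 := neg_le_gibbsWeight hM hVM Λ hφ'
    have h2 : -∑ i, |x i| ≤ ∑ i, x i * φ i := by
      rw [← Finset.sum_neg_distrib]
      refine Finset.sum_le_sum fun i _ => ?_
      have a := neg_abs_le (x i)
      nlinarith [(hφ' i).1, (hφ' i).2, abs_nonneg (x i)]
    unfold linTilt
    linarith
  have hSval : pinningMeasure ε Λ S = ∏ _i : Λ, ((1 : ℝ≥0∞) + ε) := by
    rw [hS, pinningMeasure, Measure.pi_pi]
    refine Finset.prod_congr rfl fun i _ => ?_
    rw [Measure.add_apply, Measure.smul_apply, Measure.dirac_apply' _ measurableSet_Icc,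
      Real.volume_Icc]
    simp [ENNReal.smul_def]
  have hSfin : pinningMeasure ε Λ S ≠ ∞ := by
    rw [hSval]; exact ENNReal.prod_ne_top fun i _ => by simp
  have hS1 : 1 ≤ (pinningMeasure ε Λ).real S := by
    rw [measureReal_def, hSval, ENNReal.toReal_prod]
    refine Finset.one_le_prod fun i _ => ?_
    rw [ENNReal.toReal_add (by simp) (by simp)]
    simp
  calc c ≤ c * (pinningMeasure ε Λ).real S := le_mul_of_one_le_right (Real.exp_pos _).le hS1
    _ ≤ ∫ φ in S, Real.exp (linTilt (gibbsWeight V Λ) x φ) ∂(pinningMeasure ε Λ) :=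
        setIntegral_ge_of_const_le_real hSm hSfin hbound hi.integrableOn
    _ ≤ _ := setIntegral_le_integral hi (ae_of_all _ fun φ => (Real.exp_pos _).le)

/-- The Gibbs weight in a box satisfies all growth conditions. -/
lemma exists_superlinearWeight (hV : Continuous V) (hC : 0 ≤ C)
    (h : ∀ K : ℝ, 0 ≤ K → ∀ t, K * |t| ≤ V t + C * (1 + K) ^ m)
    {M : ℝ} (hM : 0 ≤ M) (hVM : ∀ t, |t| ≤ 1 → V t ≤ M) (L : ℕ) (ε : ℝ≥0) :
    ∃ C', SuperlinearWeight (pinningMeasure ε (box 2 L)) (gibbsWeight V (box 2 L)) C' m := by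
  obtain ⟨C₁, hC₁, hup⟩ := exists_gibbsWeight_le hC h L
  -- The final `1` absorbs the term `∑ |x i|` in the lower bound on the partition function.
  set C' := C₁ + (9 / 4 * M * (box 2 L).card) + 1 with hC'
  have hcard : 0 ≤ 9 / 4 * M * (box 2 L).card := by positivity
  have hWm := measurable_gibbsWeight hV (box 2 L)
  have hup' : ∀ s, 0 ≤ s → ∀ φ,
      gibbsWeight V (box 2 L) φ ≤ -s * ∑ i, |φ i| + C' * (1 + s) ^ m := fun s hs φ => by
    refine (hup s hs φ).trans ?_
    gcongr
    linarith
  refine ⟨C', by positivity, hWm, integrable_exp_neg_sum_abs ε _, hup', fun x => ?_⟩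
  have hx : 0 ≤ ∑ i, |x i| := Finset.sum_nonneg fun _ _ => abs_nonneg _
  refine le_trans (Real.exp_le_exp.2 ?_) (exp_le_partitionFn hM hVM _ ε x ?_)
  · have : (9 / 4 * M * (box 2 L).card + 1) * (1 + ∑ i, |x i|) ≤ C' * (1 + ∑ i, |x i|) := by
      gcongr; linarith
    nlinarith
  · refine Integrable.mono' ((integrable_exp_neg_sum_abs ε (box 2 L)).const_mul
      (Real.exp (C' * (2 + ∑ i, |x i|) ^ m)))
      (measurable_linTilt_right hWm x).exp.aestronglyMeasurable (ae_of_all _ fun φ => ?_)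
    rw [Real.norm_of_nonneg (Real.exp_pos _).le, ← Real.exp_add]
    apply Real.exp_le_exp.2
    have h1 := hup' (1 + ∑ i, |x i|) (by positivity) φ
    have h2 := sum_mul_le_sum_abs_mul_sum_abs x φ
    have e : (1 + (1 + ∑ i, |x i|)) = 2 + ∑ i, |x i| := by ring
    rw [e] at h1
    unfold linTilt
    nlinarith

/-- Pinning only increases the partition function. -/
lemma partitionFn_zero_le (Λ : Finset (Site 2)) (ε : ℝ≥0) (x : Λ → ℝ)
    (hi : Integrable (fun φ => Real.exp (linTilt (gibbsWeight V Λ) x φ)) (pinningMeasure ε Λ)) :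
    partitionFn (pinningMeasure 0 Λ) (gibbsWeight V Λ) x ≤
      partitionFn (pinningMeasure ε Λ) (gibbsWeight V Λ) x := by
  rw [pinningMeasure_zero]
  exact integral_mono_measure (volume_le_pinningMeasure ε Λ)
    (ae_of_all _ fun φ => (Real.exp_pos _).le) hi

/-- Lower bound for the symmetrized free energy in terms of an arbitrary shift. -/
lemma log_partitionFn_add_log_partitionFn_neg
    (hV : ∀ a t, V (a + t) + V (a - t) ≤ 2 * V a + t ^ 2) (Λ : Finset (Site 2)) {C : ℝ} {m : ℕ}
    (hS : SuperlinearWeight (pinningMeasure 0 Λ) (gibbsWeight V Λ) C m) (x h : Λ → ℝ) :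
    2 * Real.log (partitionFn (pinningMeasure 0 Λ) (gibbsWeight V Λ) 0) +
      2 * ∑ i, x i * h i - 1 / 8 * energy (fun t => t ^ 2) Λ h ≤
    Real.log (partitionFn (pinningMeasure 0 Λ) (gibbsWeight V Λ) x) +
      Real.log (partitionFn (pinningMeasure 0 Λ) (gibbsWeight V Λ) (-x)) := by
  set W := gibbsWeight V Λ with hW
  set Z := partitionFn (pinningMeasure 0 Λ) W with hZ
  set a := Real.log (Z x) with ha
  set b := Real.log (Z (-x)) with hb
  set κ := ∑ i, x i * h i - 1 / 16 * energy (fun t => t ^ 2) Λ h with hκ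
  -- The two shifted exponents are averaged: the terms linear in `φ` cancel, the field gains `∑ x i
  -- * h i`, and the second-difference bound controls the energy. Subtracting `a` and `b` normalizes
  -- both weights.
  have hpt : ∀ φ, W φ + (κ - (a + b) / 2) ≤
      ((linTilt W x (φ + h) - a) + (linTilt W (-x) (φ - h) - b)) / 2 := by
    intro φ
    have := energy_add_sub_le hV Λ φ h
    have e1 : ∑ i, x i * (φ + h) i = ∑ i, x i * φ i + ∑ i, x i * h i := by
      simp [mul_add, Finset.sum_add_distrib]
    have e2 : ∑ i, (-x) i * (φ - h) i = -∑ i, x i * φ i + ∑ i, x i * h i := by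
      rw [← Finset.sum_neg_distrib, ← Finset.sum_add_distrib]
      refine Finset.sum_congr rfl fun i _ => ?_
      simp only [Pi.neg_apply, Pi.sub_apply]; ring
    simp only [linTilt, e1, e2, hκ, hW, gibbsWeight]
    linarith
  -- By the arithmetic-geometric mean inequality. After integration the right-hand side is `1`.
  have hexp : ∀ φ, Real.exp (linTilt W 0 φ) * Real.exp (κ - (a + b) / 2) ≤
      1 / 2 * (Real.exp (linTilt W x (φ + h)) * Real.exp (-a) +
        Real.exp (linTilt W (-x) (φ - h)) * Real.exp (-b)) := by
    intro φ
    rw [← Real.exp_add, ← Real.exp_add, ← Real.exp_add]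
    have e0 : linTilt W 0 φ = W φ := by simp [linTilt]
    rw [e0]
    refine (Real.exp_le_exp.2 (hpt φ)).trans ?_
    set p := linTilt W x (φ + h) + -a
    set q := linTilt W (-x) (φ - h) + -b
    have e : Real.exp ((linTilt W x (φ + h) - a + (linTilt W (-x) (φ - h) - b)) / 2) =
        Real.exp (p / 2) * Real.exp (q / 2) := by
      rw [← Real.exp_add]; congr 1; simp only [p, q]; ring
    have ep : Real.exp p = Real.exp (p / 2) ^ 2 := by rw [sq, ← Real.exp_add]; ring_nf
    have eq : Real.exp q = Real.exp (q / 2) ^ 2 := by rw [sq, ← Real.exp_add]; ring_nf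
    rw [e, ep, eq]
    nlinarith [sq_nonneg (Real.exp (p / 2) - Real.exp (q / 2))]
  have i0 := hS.integrable_exp_linTilt 0
  have i1 := hS.integrable_exp_linTilt x
  have i2 := hS.integrable_exp_linTilt (-x)
  have z1 := hS.partitionFn_pos x
  have z2 := hS.partitionFn_pos (-x)
  have z0 := hS.partitionFn_pos 0
  -- Translation invariance, available because the reference measure at `ε = 0` is Lebesgue measure.
  have t1 : ∫ φ, Real.exp (linTilt W x (φ + h)) ∂(pinningMeasure 0 Λ) = Z x := by
    simp only [hZ, partitionFn, pinningMeasure_zero]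
    exact integral_add_right_eq_self (fun φ => Real.exp (linTilt W x φ)) h
  have t2 : ∫ φ, Real.exp (linTilt W (-x) (φ - h)) ∂(pinningMeasure 0 Λ) = Z (-x) := by
    simp only [hZ, partitionFn, pinningMeasure_zero]
    exact integral_sub_right_eq_self (fun φ => Real.exp (linTilt W (-x) φ)) h
  have i1' : Integrable (fun φ => Real.exp (linTilt W x (φ + h))) (pinningMeasure 0 Λ) := by
    rw [pinningMeasure_zero] at i1 ⊢; exact i1.comp_add_right h
  have i2' : Integrable (fun φ => Real.exp (linTilt W (-x) (φ - h))) (pinningMeasure 0 Λ) := by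
    rw [pinningMeasure_zero] at i2 ⊢; exact i2.comp_sub_right h
  have hint := integral_mono (i0.mul_const _)
    (((i1'.mul_const (Real.exp (-a))).add (i2'.mul_const (Real.exp (-b)))).const_mul (1 / 2)) hexp
  simp only [Pi.add_apply] at hint
  rw [integral_mul_const, integral_const_mul, integral_add (i1'.mul_const _) (i2'.mul_const _),
    integral_mul_const, integral_mul_const, t1, t2, Real.exp_neg, Real.exp_neg, ha, hb,
    Real.exp_log z1, Real.exp_log z2, mul_inv_cancel₀ z1.ne', mul_inv_cancel₀ z2.ne'] at hint
  rw [← ha, ← hb] at hint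
  change Z 0 * _ ≤ _ at hint
  have hl := Real.log_le_log (mul_pos z0 (Real.exp_pos _)) hint
  rw [Real.log_mul z0.ne' (Real.exp_pos _).ne', Real.log_exp] at hl
  norm_num at hl
  linarith

end GibbsWeight

/-! ### Exponential upper bound on the partition function without field. -/

section GibbsWeight

variable {V : ℝ → ℝ} {C : ℝ} {m : ℕ}

/-- Each factor involves a site and its right neighbour only, so the peeling applies with the first
coordinate as key. One integration gives at most `∫ u` from the Lebesgue part, by translation
invariance, and at most `ε` from the atom, since `u ≤ 1`. -/
lemma lintegral_prod_row_le {u : ℝ → ℝ} (hum : Measurable u) (hu0 : ∀ t, 0 ≤ u t)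
    (hu1 : ∀ t, u t ≤ 1) (hui : Integrable u) (ε : ℝ≥0) (Λ : Finset (Site 2)) :
    ∫⁻ φ, ∏ i : Λ, ENNReal.ofReal (u (φ i - zeroExtend Λ φ (i + rowShift))) ∂(pinningMeasure ε Λ) ≤
      ENNReal.ofReal ((∫ t, u t) + ε) ^ Λ.card := by
  have hI0 : 0 ≤ ∫ t, u t := integral_nonneg hu0
  have hzm : ∀ j, Measurable fun φ : Λ → ℝ => zeroExtend Λ φ j := fun j => by
    by_cases hj : j ∈ Λ
    · simp only [zeroExtend_of_mem _ hj]; fun_prop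
    · simp only [zeroExtend_of_notMem _ hj]; fun_prop
  have hgm : ∀ i : Λ, Measurable fun φ : Λ → ℝ =>
      ENNReal.ofReal (u (φ i - zeroExtend Λ φ (i + rowShift))) := fun i =>
    ENNReal.measurable_ofReal.comp (hum.comp ((measurable_pi_apply i).sub (hzm _)))
  rw [← Fintype.card_coe Λ]
  refine lintegral_prod_le_pow
    (μ := fun _ : Λ => (volume : Measure ℝ) + ε • Measure.dirac (0 : ℝ)) _ hgm
    (fun i => (i : Site 2) 0) (fun i φ ψ h1 h2 => ?_) (fun i φ => ?_)
  · have : zeroExtend Λ φ (i + rowShift) = zeroExtend Λ ψ (i + rowShift) := by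
      by_cases hj : (i : Site 2) + rowShift ∈ Λ
      · rw [zeroExtend_of_mem _ hj, zeroExtend_of_mem _ hj]
        exact h2 ⟨_, hj⟩ (by simp [rowShift_zero])
      · rw [zeroExtend_of_notMem _ hj, zeroExtend_of_notMem _ hj]
    rw [h1, this]
  · have e : ∀ t, zeroExtend Λ (Function.update φ i t) (i + rowShift) =
        zeroExtend Λ φ (i + rowShift) := fun t => by
      by_cases hj : (i : Site 2) + rowShift ∈ Λ
      · rw [zeroExtend_of_mem _ hj, zeroExtend_of_mem _ hj, Function.update_of_ne]
        intro hcon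
        have := congrArg (fun j : Λ => (j : Site 2)) hcon
        exact (lt_add_rowShift (i : Site 2)).ne' this
      · rw [zeroExtend_of_notMem _ hj, zeroExtend_of_notMem _ hj]
    simp only [e, Function.update_self]
    rw [lintegral_add_measure, lintegral_smul_measure, lintegral_dirac,
      lintegral_sub_right_eq_self (fun t => ENNReal.ofReal (u t)),
      ← ofReal_integral_eq_lintegral_ofReal hui (ae_of_all _ hu0),
      ENNReal.ofReal_add hI0 ε.coe_nonneg, ENNReal.smul_def, smul_eq_mul,
      ENNReal.ofReal_coe_nnreal]
    refine add_le_add le_rfl ?_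
    calc (ε : ℝ≥0∞) * _ ≤ ε * 1 := by
          gcongr
          exact ENNReal.ofReal_le_one.2 (hu1 _)
      _ = ε := mul_one _

lemma ofReal_exp_mul_pow_le (a : ℝ) {b : ℝ} (hb : 0 ≤ b) (n : ℕ) :
    ENNReal.ofReal (Real.exp (a * n)) * ENNReal.ofReal b ^ n ≤
      ENNReal.ofReal (Real.exp ((a + b) * n)) := by
  rw [← ENNReal.ofReal_pow hb, ← ENNReal.ofReal_mul (Real.exp_pos _).le]
  apply ENNReal.ofReal_le_ofReal
  rw [add_mul, Real.exp_add]
  refine mul_le_mul_of_nonneg_left ?_ (Real.exp_pos _).le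
  rw [mul_comm b, Real.exp_nat_mul]
  exact pow_le_pow_left₀ hb (by linarith [Real.add_one_le_exp b]) _

/-- The partition function without field grows at most exponentially in the volume. -/
lemma exists_partitionFn_zero_le (hV : Continuous V) (hC : 0 ≤ C)
    (h : ∀ K : ℝ, 0 ≤ K → ∀ t, K * |t| ≤ V t + C * (1 + K) ^ m) (ε : ℝ≥0) :
    ∃ D : ℝ, ∀ Λ : Finset (Site 2),
      partitionFn (pinningMeasure ε Λ) (gibbsWeight V Λ) 0 ≤ Real.exp (D * Λ.card) := by
  have hU : ∀ t, 0 ≤ V t + C := fun t => by simpa using h 0 le_rfl t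
  obtain ⟨u, hu⟩ : ∃ u : ℝ → ℝ, u = fun t => Real.exp (-(V t + C) / 8) := ⟨_, rfl⟩
  have hu0 : ∀ t, 0 ≤ u t := fun t => by rw [hu]; positivity
  have hum : Measurable u := by rw [hu]; fun_prop
  have hu1 : ∀ t, u t ≤ 1 := fun t => by
    rw [hu]; exact Real.exp_le_one_iff.2 (by linarith [hU t])
  -- Slope `8` offsets the prefactor `1 / 8` and makes `u` bounded by a multiple of `exp (-|t|)`.
  obtain ⟨P, hP⟩ : ∃ P : ℝ, ∀ t, 8 * |t| ≤ V t + P := ⟨_, h 8 (by norm_num)⟩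
  have hui : Integrable u := by
    refine Integrable.mono' (integrable_exp_neg_abs.const_mul (Real.exp (P / 8)))
      hum.aestronglyMeasurable (ae_of_all _ fun t => ?_)
    rw [Real.norm_of_nonneg (hu0 t), ← Real.exp_add, hu]
    apply Real.exp_le_exp.2
    linarith [hP t]
  refine ⟨9 / 4 * C + ((∫ t, u t) + ε), fun Λ => ?_⟩
  have hI0 : 0 ≤ ∫ t, u t := integral_nonneg hu0
  have hprod := lintegral_prod_row_le hum hu0 hu1 hui ε Λ
  have hbound : ∀ φ : Λ → ℝ, ENNReal.ofReal (Real.exp (linTilt (gibbsWeight V Λ) 0 φ)) ≤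
      ENNReal.ofReal (Real.exp (9 / 4 * C * Λ.card)) *
        ∏ i : Λ, ENNReal.ofReal (u (φ i - zeroExtend Λ φ (i + rowShift))) := by
    intro φ
    rw [← ENNReal.ofReal_prod_of_nonneg fun i _ => hu0 _,
      ← ENNReal.ofReal_mul (Real.exp_pos _).le]
    apply ENNReal.ofReal_le_ofReal
    rw [hu, ← Real.exp_sum, ← Real.exp_add]
    apply Real.exp_le_exp.2
    have := sum_row_sub_le_energy hC hU Λ φ
    rw [← Finset.sum_div, Finset.sum_neg_distrib]
    simp only [linTilt, gibbsWeight, Pi.zero_apply, zero_mul, Finset.sum_const_zero]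
    linarith
  have hWm := (measurable_linTilt_right (measurable_gibbsWeight hV Λ) 0).exp
  unfold partitionFn
  rw [integral_eq_lintegral_of_nonneg_ae (ae_of_all _ fun φ => (Real.exp_pos _).le)
    hWm.aestronglyMeasurable]
  refine ENNReal.toReal_le_of_le_ofReal (Real.exp_pos _).le 
    (le_trans ?_ (ofReal_exp_mul_pow_le _ (by positivity) _))
  refine (lintegral_mono hbound).trans ?_
  rw [lintegral_const_mul' _ _ ENNReal.ofReal_ne_top]
  exact mul_le_mul_right hprod _

end GibbsWeight

/-! ### Covariances of linear forms in independent Gaussians. -/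

section GaussianPairing

variable {ι : Type*} [Fintype ι]

lemma memLp_eval_gaussianPi (v : ℝ≥0) (i : ι) :
    MemLp (fun x : ι → ℝ => x i) 2 (gaussianPi ι v) :=
  (memLp_id_gaussianReal' 2 (by simp)).comp_measurePreserving
    (measurePreserving_eval (fun _ : ι => gaussianReal 0 v) i)

lemma integrable_mul_gaussianPi (v : ℝ≥0) (i j : ι) :
    Integrable (fun x : ι → ℝ => x i * x j) (gaussianPi ι v) :=
  (memLp_eval_gaussianPi v i).integrable_mul (memLp_eval_gaussianPi v j)

lemma integral_eval_gaussianPi (v : ℝ≥0) (i : ι) :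
    ∫ x, x i ∂(gaussianPi ι v) = 0 := by
  have := integral_map (μ := gaussianPi ι v) (φ := fun x => x i) (f := fun t : ℝ => t)
    (measurable_pi_apply i).aemeasurable (by fun_prop)
  rw [(measurePreserving_eval (fun _ : ι => gaussianReal 0 v) i).map_eq,
    integral_id_gaussianReal] at this
  exact this.symm

lemma integral_mul_gaussianPi [DecidableEq ι] (v : ℝ≥0) (i j : ι) :
    ∫ x, x i * x j ∂(gaussianPi ι v) = if i = j then (v : ℝ) else 0 := by
  split_ifs with h
  · subst h
    have := integral_map (μ := gaussianPi ι v) (φ := fun x => x i) (f := fun t : ℝ => t * t)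
      (measurable_pi_apply i).aemeasurable (by fun_prop)
    rw [(measurePreserving_eval (fun _ : ι => gaussianReal 0 v) i).map_eq] at this
    rw [← this]
    have hv := variance_fun_id_gaussianReal (μ := 0) (v := v)
    rw [variance_eq_sub (X := fun x => x) (memLp_id_gaussianReal' 2 (by simp)), integral_id_gaussianReal] at hv
    rw [← hv]
    simp [sq]
  · have hind : iIndepFun (fun i (x : ι → ℝ) => x i) (gaussianPi ι v) :=
      iIndepFun_pi (μ := fun _ : ι => gaussianReal 0 v) (X := fun _ t => t) fun _ => by fun_prop
    have := (hind.indepFun h).integral_fun_mul_eq_mul_integral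
      (measurable_pi_apply i).aestronglyMeasurable (measurable_pi_apply j).aestronglyMeasurable
    rw [this, integral_eval_gaussianPi, zero_mul]

lemma integrable_sum_mul_sum_gaussianPi (v : ℝ≥0) (a b : ι → ℝ) :
    Integrable (fun x : ι → ℝ => (∑ i, x i * a i) * ∑ j, x j * b j) (gaussianPi ι v) := by
  simp_rw [Finset.sum_mul_sum]
  refine integrable_finsetSum _ fun i _ => integrable_finsetSum _ fun j _ => ?_
  refine ((integrable_mul_gaussianPi v i j).mul_const (a i * b j)).congr
    (ae_of_all _ fun x => ?_)
  dsimp only; ring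

lemma integral_sum_mul_sum_gaussianPi (v : ℝ≥0) (a b : ι → ℝ) :
    ∫ x, (∑ i, x i * a i) * ∑ j, x j * b j ∂(gaussianPi ι v) = v * ∑ i, a i * b i := by
  classical
  have e : ∀ x : ι → ℝ, (∑ i, x i * a i) * ∑ j, x j * b j =
      ∑ i, ∑ j, x i * x j * (a i * b j) := fun x => by
    rw [Finset.sum_mul_sum]
    refine Finset.sum_congr rfl fun i _ => Finset.sum_congr rfl fun j _ => by ring
  simp_rw [e]
  have hi : ∀ i j, Integrable (fun x : ι → ℝ => x i * x j * (a i * b j)) (gaussianPi ι v) :=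
    fun i j => (integrable_mul_gaussianPi v i j).mul_const _
  rw [integral_finsetSum _ fun i _ => integrable_finsetSum _ fun j _ => hi i j, Finset.mul_sum]
  refine Finset.sum_congr rfl fun i _ => ?_
  rw [integral_finsetSum _ fun j _ => hi i j]
  simp_rw [integral_mul_const, integral_mul_gaussianPi]
  simp

lemma measurePreserving_neg_gaussianPi (v : ℝ≥0) :
    MeasurePreserving (fun x : ι → ℝ => -x) (gaussianPi ι v) (gaussianPi ι v) :=
  measurePreserving_pi (fun _ : ι => gaussianReal 0 v) (fun _ : ι => gaussianReal 0 v)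
    (f := fun _ t => -t)
    fun _ => ⟨measurable_neg, by simpa using gaussianReal_map_neg (μ := 0) (v := v)⟩

end GaussianPairing

/-! ### Mean quadratic energy of a random superposition of shifts. -/

section Quadratic

variable (Λ : Finset (Site 2)) (v : ℝ≥0) (u : Λ → Λ → ℝ)

/-- The superposition of the shifts `u j` with the field strengths `x j`. -/
def fieldShift (x : Λ → ℝ) (i : Λ) : ℝ := ∑ j, x j * u j i

lemma integrable_sq_and_integral_sq_gaussianPi {ι : Type*} [Fintype ι] (v : ℝ≥0) (c : ι → ℝ) :
    Integrable (fun x : ι → ℝ => (∑ i, x i * c i) ^ 2) (gaussianPi ι v) ∧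
      ∫ x, (∑ i, x i * c i) ^ 2 ∂(gaussianPi ι v) = v * ∑ i, c i ^ 2 := by
  simp_rw [sq]
  exact ⟨integrable_sum_mul_sum_gaussianPi v c c, integral_sum_mul_sum_gaussianPi v c c⟩

/-- Each gradient of the superposition is a linear form in the fields, so independence removes all
cross terms; no orthogonality between the shifts is needed. -/
lemma integrable_and_integral_bulkEnergy_sq :
    Integrable (fun x => bulkEnergy (fun t => t ^ 2) Λ (fieldShift Λ u x)) (gaussianPi Λ v) ∧
    ∫ x, bulkEnergy (fun t => t ^ 2) Λ (fieldShift Λ u x) ∂(gaussianPi Λ v) =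
      v * ∑ j, bulkEnergy (fun t => t ^ 2) Λ (u j) := by
  classical
  have e : ∀ x (i k : Λ), fieldShift Λ u x i - fieldShift Λ u x k =
      ∑ j, x j * (u j i - u j k) := fun x i k => by
    simp [fieldShift, ← Finset.sum_sub_distrib, mul_sub]
  have key : ∀ i k : Λ,
      Integrable (fun x => if NearestNeighbour (i : Site 2) k ∧ (i : Site 2) < k then
        (fieldShift Λ u x i - fieldShift Λ u x k) ^ 2 else 0) (gaussianPi Λ v) ∧
      ∫ x, (if NearestNeighbour (i : Site 2) k ∧ (i : Site 2) < k then
        (fieldShift Λ u x i - fieldShift Λ u x k) ^ 2 else 0) ∂(gaussianPi Λ v) =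
      v * ∑ j, if NearestNeighbour (i : Site 2) k ∧ (i : Site 2) < k then
        (u j i - u j k) ^ 2 else 0 := by
    intro i k
    split_ifs with h
    · simp_rw [e]
      exact integrable_sq_and_integral_sq_gaussianPi v fun j => u j i - u j k
    · simp
  unfold bulkEnergy
  refine ⟨integrable_finsetSum _ fun i _ => integrable_finsetSum _ fun k _ => (key i k).1, ?_⟩
  rw [integral_finsetSum _ fun i _ => integrable_finsetSum _ fun k _ => (key i k).1,
    Finset.sum_comm, Finset.mul_sum]
  refine Finset.sum_congr rfl fun i _ => ?_
  rw [integral_finsetSum _ fun k _ => (key i k).1, Finset.sum_comm, Finset.mul_sum]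
  exact Finset.sum_congr rfl fun k _ => (key i k).2

lemma integrable_and_integral_boundaryEnergy_sq :
    Integrable (fun x => boundaryEnergy (fun t => t ^ 2) Λ (fieldShift Λ u x)) (gaussianPi Λ v) ∧
    ∫ x, boundaryEnergy (fun t => t ^ 2) Λ (fieldShift Λ u x) ∂(gaussianPi Λ v) =
      v * ∑ j, boundaryEnergy (fun t => t ^ 2) Λ (u j) := by
  have key : ∀ i : Λ, Integrable (fun x => fieldShift Λ u x i ^ 2) (gaussianPi Λ v) ∧
      ∫ x, fieldShift Λ u x i ^ 2 ∂(gaussianPi Λ v) = v * ∑ j, u j i ^ 2 := fun i =>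
    integrable_sq_and_integral_sq_gaussianPi v fun j => u j i
  unfold boundaryEnergy
  refine ⟨integrable_finsetSum _ fun i _ => integrable_finsetSum _ fun k _ => (key i).1, ?_⟩
  rw [integral_finsetSum _ fun i _ => integrable_finsetSum _ fun k _ => (key i).1,
    Finset.sum_comm, Finset.mul_sum]
  refine Finset.sum_congr rfl fun i _ => ?_
  rw [integral_finsetSum _ fun k _ => (key i).1, Finset.sum_comm, Finset.mul_sum]
  exact Finset.sum_congr rfl fun k _ => (key i).2

lemma integrable_energy_sq :
    Integrable (fun x => energy (fun t => t ^ 2) Λ (fieldShift Λ u x)) (gaussianPi Λ v) :=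
  (integrable_and_integral_bulkEnergy_sq Λ v u).1.add
    (integrable_and_integral_boundaryEnergy_sq Λ v u).1

lemma integral_energy_sq :
    ∫ x, energy (fun t => t ^ 2) Λ (fieldShift Λ u x) ∂(gaussianPi Λ v) =
      v * ∑ j, energy (fun t => t ^ 2) Λ (u j) := by
  unfold energy
  rw [integral_add (integrable_and_integral_bulkEnergy_sq Λ v u).1
    (integrable_and_integral_boundaryEnergy_sq Λ v u).1,
    (integrable_and_integral_bulkEnergy_sq Λ v u).2,
    (integrable_and_integral_boundaryEnergy_sq Λ v u).2, Finset.sum_add_distrib, mul_add]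

lemma integrable_mul_fieldShift (i : Λ) :
    Integrable (fun x => x i * fieldShift Λ u x i) (gaussianPi Λ v) := by
  simp_rw [fieldShift, Finset.mul_sum]
  refine integrable_finsetSum _ fun j _ => ?_
  simp_rw [← mul_assoc]
  exact (integrable_mul_gaussianPi v i j).mul_const _

lemma integral_mul_fieldShift (i : Λ) :
    ∫ x, x i * fieldShift Λ u x i ∂(gaussianPi Λ v) = v * u i i := by
  classical
  simp_rw [fieldShift, Finset.mul_sum, ← mul_assoc]
  rw [integral_finsetSum _ fun j _ => (integrable_mul_gaussianPi v i j).mul_const _]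
  simp_rw [integral_mul_const, integral_mul_gaussianPi]
  simp

end Quadratic

/-! ### From trial shifts to a lower bound on the total variance. -/

section FreeEnergyBound

open SuperlinearWeight

variable {V : ℝ → ℝ} {C C₀ : ℝ} {m m₀ : ℕ}

/-- Lower bound for the total averaged variance by a trial family of shifts. -/
lemma mul_sum_integral_tiltVar_ge (hV : ∀ a t, V (a + t) + V (a - t) ≤ 2 * V a + t ^ 2)
    (Λ : Finset (Site 2)) (ε : ℝ≥0)
    (hS : SuperlinearWeight (pinningMeasure ε Λ) (gibbsWeight V Λ) C m)
    (hS₀ : SuperlinearWeight (pinningMeasure 0 Λ) (gibbsWeight V Λ) C₀ m₀)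
    {v : ℝ≥0} (hv : v ≠ 0) (u : Λ → Λ → ℝ) :
    v * ∑ i, (u i i - 1 / 16 * energy (fun t => t ^ 2) Λ (u i)) +
      Real.log (partitionFn (pinningMeasure 0 Λ) (gibbsWeight V Λ) 0) -
      Real.log (partitionFn (pinningMeasure ε Λ) (gibbsWeight V Λ) 0) ≤
    v * ∑ i, ∫ x, tiltVar (pinningMeasure ε Λ) (gibbsWeight V Λ) i x ∂(gaussianPi Λ v) := by
  set ν := pinningMeasure ε Λ
  set W := gibbsWeight V Λ
  set Z₀ := Real.log (partitionFn (pinningMeasure 0 Λ) W 0)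
  set Z := Real.log (partitionFn ν W 0)
  set g : (Λ → ℝ) → ℝ := fun x => ∑ i, x i * tiltMean ν W i x with hg
  have hgi : Integrable g (gaussianPi Λ v) :=
    integrable_finsetSum _ fun i _ => hS.integrable_mul_tiltMean v i
  have hgv : ∫ x, g x ∂(gaussianPi Λ v) = v * ∑ i, ∫ x, tiltVar ν W i x ∂(gaussianPi Λ v) := by
    rw [hg, integral_finsetSum _ fun i _ => hS.integrable_mul_tiltMean v i, Finset.mul_sum]
    exact Finset.sum_congr rfl fun i _ => hS.integral_mul_tiltMean hv i
  have hneg := measurePreserving_neg_gaussianPi (ι := Λ) v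
  have hgni : Integrable (fun x => g (-x)) (gaussianPi Λ v) :=
    (hneg.integrable_comp hgi.aestronglyMeasurable).2 hgi
  have hgnv : ∫ x, g (-x) ∂(gaussianPi Λ v) = ∫ x, g x ∂(gaussianPi Λ v) :=
    hneg.integral_comp (MeasurableEquiv.neg (Λ → ℝ)).measurableEmbedding g
  -- The overlaps at `x` and `-x` are added so that the symmetrized free energy bound applies; they
  -- have the same mean because the Gaussian law is even.
  have hpt : ∀ x, (2 * ∑ i, x i * fieldShift Λ u x i -
      1 / 8 * energy (fun t => t ^ 2) Λ (fieldShift Λ u x)) + (2 * Z₀ - 2 * Z) ≤ g x + g (-x) := by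
    intro x
    have h1 := hS.log_partitionFn_sub_le x
    have h2 := hS.log_partitionFn_sub_le (-x)
    have h3 := log_partitionFn_add_log_partitionFn_neg hV Λ hS₀ x (fieldShift Λ u x)
    have h4 := Real.log_le_log (hS₀.partitionFn_pos x)
      (partitionFn_zero_le Λ ε x (hS.integrable_exp_linTilt x))
    have h5 := Real.log_le_log (hS₀.partitionFn_pos (-x))
      (partitionFn_zero_le Λ ε (-x) (hS.integrable_exp_linTilt (-x)))
    change _ ≤ g x at h1
    change _ ≤ g (-x) at h2
    linarith
  have hi1 : Integrable (fun x => ∑ i, x i * fieldShift Λ u x i) (gaussianPi Λ v) :=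
    integrable_finsetSum _ fun i _ => integrable_mul_fieldShift Λ v u i
  have hi2 := integrable_energy_sq Λ v u
  have hi3 : Integrable (fun x => 2 * ∑ i, x i * fieldShift Λ u x i -
      1 / 8 * energy (fun t => t ^ 2) Λ (fieldShift Λ u x)) (gaussianPi Λ v) :=
    (hi1.const_mul 2).sub (hi2.const_mul (1 / 8))
  have hint := integral_mono (hi3.add (integrable_const (2 * Z₀ - 2 * Z))) (hgi.add hgni) hpt
  simp only [Pi.add_apply] at hint
  rw [integral_add hi3 (integrable_const _),
    integral_sub (hi1.const_mul 2) (hi2.const_mul (1 / 8)), integral_const_mul, integral_const_mul,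
    integral_energy_sq, integral_add hgi hgni, hgnv,
    integral_finsetSum _ fun i _ => integrable_mul_fieldShift Λ v u i] at hint
  simp_rw [integral_mul_fieldShift] at hint
  rw [← Finset.mul_sum] at hint
  simp only [integral_const, probReal_univ, one_smul] at hint
  rw [← hgv, Finset.sum_sub_distrib, ← Finset.mul_sum]
  linarith

end FreeEnergyBound

/-! ### The logarithmic trial profile and its Dirichlet energy. -/

section LogarithmicProfile

/-- The sup norm on `ℤ²`, as a natural number. -/
def supNorm (y : Site 2) : ℕ := max (y 0).natAbs (y 1).natAbs

/-- The partial sums of the harmonic series. -/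
def harmonicSum (n : ℕ) : ℝ := ∑ l ∈ Finset.range n, 1 / ((l : ℝ) + 1)

/-- The radial profile `∑_{k ≤ l < R} 1 / (l + 1)`. -/
def logProfile (R k : ℕ) : ℝ := ∑ l ∈ Finset.Ico k R, 1 / ((l : ℝ) + 1)

lemma log_add_one_le_harmonicSum (n : ℕ) : Real.log (n + 1) ≤ harmonicSum n := by
  have h := log_add_one_le_harmonic n
  have e : ((harmonic n : ℚ) : ℝ) = harmonicSum n := by
    simp [harmonic, harmonicSum]
  rw [← e]
  exact_mod_cast h

lemma logProfile_zero (R : ℕ) : logProfile R 0 = harmonicSum R := by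
  simp [logProfile, harmonicSum]

lemma logProfile_of_le {R k : ℕ} (h : R ≤ k) : logProfile R k = 0 := by
  simp [logProfile, Finset.Ico_eq_empty_of_le h]

lemma logProfile_of_lt {R k : ℕ} (h : k < R) :
    logProfile R k = 1 / ((k : ℝ) + 1) + logProfile R (k + 1) := by
  simp [logProfile, Finset.sum_eq_sum_Ico_succ_bot h]

/-- The largest increment at radius `k` is the inward one, `1 / k ≤ 2 / (k + 1)`, whence the `4`.
The radius `k = R` must be included because its inward neighbour is still in the support. -/
lemma sq_logProfile_sub_le (R : ℕ) {k l : ℕ} (h1 : k ≤ l + 1) (h2 : l ≤ k + 1) :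
    (logProfile R k - logProfile R l) ^ 2 ≤ if k ≤ R then 4 / ((k : ℝ) + 1) ^ 2 else 0 := by
  have hpos : (0 : ℝ) ≤ if k ≤ R then 4 / ((k : ℝ) + 1) ^ 2 else 0 := by
    split_ifs <;> positivity
  obtain h | h | h : l = k ∨ l = k + 1 ∨ k = l + 1 := by omega
  · subst h; simpa using hpos
  · subst h
    rcases lt_or_ge k R with hk | hk
    · rw [logProfile_of_lt hk, if_pos hk.le]
      rw [add_sub_cancel_right, div_pow]
      gcongr
      norm_num
    · rw [logProfile_of_le hk, logProfile_of_le (by omega)]; simpa using hpos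
  · subst h
    rcases lt_or_ge l R with hk | hk
    · rw [logProfile_of_lt hk, if_pos (by omega : l + 1 ≤ R), sub_add_cancel_right, neg_sq, div_pow,
        div_le_div_iff₀ (by positivity) (by positivity)]
      push_cast
      have : (0 : ℝ) ≤ l := Nat.cast_nonneg l
      nlinarith
    · rw [logProfile_of_le hk, logProfile_of_le (by omega)]; simpa using hpos

lemma mem_box_iff_supNorm_le {L : ℕ} {y : Site 2} : y ∈ box 2 L ↔ supNorm y ≤ L := by
  rw [mem_box, Fin.forall_fin_two, supNorm, max_le_iff, Int.abs_eq_natAbs, Int.abs_eq_natAbs]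
  omega

lemma card_box_two (L : ℕ) : (box 2 L).card = (2 * L + 1) ^ 2 := by
  rw [box, Pi.card_Icc]
  simp only [Int.card_Icc, Finset.prod_const, Finset.card_univ, Fintype.card_fin]
  congr 1
  omega

/-- The shell of radius `r ≥ 1` has `8 * r` sites, so it contributes at most `8 / (r + 1)`. This is
where dimension two produces the logarithm. -/
lemma sum_box_inv_sq_le (R : ℕ) :
    ∑ y ∈ box 2 R, 1 / ((supNorm y : ℝ) + 1) ^ 2 ≤ 8 * harmonicSum (R + 1) := by
  induction R with
  | zero =>
    have : box 2 0 = {0} := by simp [box]; rfl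
    rw [this]
    simp [supNorm, harmonicSum]
  | succ R ih =>
    have hsub : box 2 R ⊆ box 2 (R + 1) := fun y hy => by
      rw [mem_box_iff_supNorm_le] at hy ⊢; omega
    rw [← Finset.sum_sdiff hsub]
    have h1 : ∑ y ∈ box 2 (R + 1) \ box 2 R, 1 / ((supNorm y : ℝ) + 1) ^ 2 =
        ∑ _y ∈ box 2 (R + 1) \ box 2 R, 1 / ((R : ℝ) + 2) ^ 2 := by
      refine Finset.sum_congr rfl fun y hy => ?_
      rw [Finset.mem_sdiff, mem_box_iff_supNorm_le, mem_box_iff_supNorm_le] at hy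
      have : supNorm y = R + 1 := by omega
      rw [this]; push_cast; ring_nf
    have h2 : ((box 2 (R + 1) \ box 2 R).card : ℝ) = 8 * (R + 1) := by
      rw [Finset.cast_card_sdiff hsub, card_box_two, card_box_two]
      push_cast; ring
    have h3 : harmonicSum (R + 1 + 1) = harmonicSum (R + 1) + 1 / ((R : ℝ) + 2) := by
      rw [harmonicSum, Finset.sum_range_succ, ← harmonicSum]; push_cast; ring_nf
    rw [h1, Finset.sum_const, nsmul_eq_mul, h2, h3]
    have h4 : 8 * ((R : ℝ) + 1) * (1 / ((R : ℝ) + 2) ^ 2) ≤ 8 * (1 / ((R : ℝ) + 2)) := by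
      rw [mul_assoc]
      gcongr
      rw [mul_one_div, div_le_div_iff₀ (by positivity) (by positivity)]
      nlinarith [(Nat.cast_nonneg R : (0 : ℝ) ≤ R)]
    linarith

lemma harmonicSum_succ_le (R : ℕ) : harmonicSum (R + 1) ≤ harmonicSum R + 1 := by
  rw [harmonicSum, Finset.sum_range_succ, ← harmonicSum]
  gcongr
  rw [div_le_one (by positivity)]
  linarith [(Nat.cast_nonneg R : (0 : ℝ) ≤ R)]

lemma NearestNeighbour.supNorm_le {i j : Site 2} (h : NearestNeighbour i j) (c : Site 2) :
    supNorm (i - c) ≤ supNorm (j - c) + 1 ∧ supNorm (j - c) ≤ supNorm (i - c) + 1 := by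
  have h' : |i 0 - j 0| + |i 1 - j 1| = 1 := by simpa [NearestNeighbour] using h
  rw [Int.abs_eq_natAbs, Int.abs_eq_natAbs] at h'
  simp only [supNorm, Pi.sub_apply]
  omega

/-- The logarithmic shift centred at `c`. -/
def logShift (L R : ℕ) (c : Site 2) (i : box 2 L) : ℝ := 1 / 36 * logProfile R (supNorm (i - c))

/-- A site with a neighbour outside the box has norm at least `L ≥ 2 * R`. It is therefore at
distance at least `R` from `c`, where the profile vanishes. -/
lemma boundaryEnergy_logShift {L R : ℕ} (hR : 2 * R ≤ L) {c : Site 2} (hc : c ∈ box 2 R) :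
    boundaryEnergy (fun t => t ^ 2) (box 2 L) (logShift L R c) = 0 := by
  classical
  unfold boundaryEnergy
  refine Finset.sum_eq_zero fun i _ => Finset.sum_eq_zero fun j hj => ?_
  rw [Finset.mem_filter] at hj
  obtain ⟨-, hjL, hij⟩ := hj
  rw [mem_box_iff_supNorm_le] at hc hjL
  have h1 := (hij.supNorm_le 0).2
  simp only [sub_zero] at h1
  have h2 : supNorm (i : Site 2) ≤ supNorm ((i : Site 2) - c) + supNorm c := by
    simp only [supNorm, Pi.sub_apply]; omega
  simp [logShift, logProfile_of_le (by omega : R ≤ supNorm ((i : Site 2) - c))]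

/-- Scaling the profile by `s` gives energy at most `9 * 4 * 8 * s ^ 2 = 288 * s ^ 2` times the
harmonic sum, up to the added `1`. The net gain `s - 18 * s ^ 2` per unit of harmonic sum is maximal
at `s = 1 / 36`, with value `1 / 72`. -/
lemma bulkEnergy_logShift_le (L R : ℕ) (c : Site 2) :
    bulkEnergy (fun t => t ^ 2) (box 2 L) (logShift L R c) ≤ 2 / 9 * (harmonicSum R + 1) := by
  classical
  have h1 : bulkEnergy (fun t => t ^ 2) (box 2 L) (logShift L R c) ≤
      ∑ i : box 2 L, 9 * (1 / 36 ^ 2 * if supNorm ((i : Site 2) - c) ≤ R then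
        4 / ((supNorm ((i : Site 2) - c) : ℝ) + 1) ^ 2 else 0) := by
    refine Finset.sum_le_sum fun i _ => sum_bond_le _ i (by split_ifs <;> positivity) fun j hij => ?_
    have := sq_logProfile_sub_le R (hij.supNorm_le c).1 (hij.supNorm_le c).2
    have e : (logShift L R c i - logShift L R c j) ^ 2 = 1 / 36 ^ 2 *
        (logProfile R (supNorm (i - c)) - logProfile R (supNorm (j - c))) ^ 2 := by
      unfold logShift; ring
    refine e.le.trans ?_
    gcongr
  have h2 : ∑ i : box 2 L, (if supNorm ((i : Site 2) - c) ≤ R then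
        4 / ((supNorm ((i : Site 2) - c) : ℝ) + 1) ^ 2 else 0) ≤
      4 * ∑ y ∈ box 2 R, 1 / ((supNorm y : ℝ) + 1) ^ 2 := by
    rw [Finset.sum_coe_sort (box 2 L) fun i => if supNorm (i - c) ≤ R then
        4 / ((supNorm (i - c) : ℝ) + 1) ^ 2 else 0, ← Finset.sum_filter, Finset.mul_sum]
    rw [← Finset.sum_image (s := (box 2 L).filter fun i => supNorm (i - c) ≤ R)
      (g := fun i => i - c) (f := fun y => 4 / ((supNorm y : ℝ) + 1) ^ 2)
      fun a _ b _ h => sub_left_injective h]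
    calc _ ≤ ∑ y ∈ box 2 R, 4 / ((supNorm y : ℝ) + 1) ^ 2 := by
          refine Finset.sum_le_sum_of_subset_of_nonneg ?_ fun _ _ _ => by positivity
          intro y hy
          obtain ⟨i, hi, rfl⟩ := Finset.mem_image.1 hy
          exact mem_box_iff_supNorm_le.2 (Finset.mem_filter.1 hi).2
      _ = _ := Finset.sum_congr rfl fun y _ => by ring
  have h3 := sum_box_inv_sq_le R
  have h4 := harmonicSum_succ_le R
  rw [← Finset.mul_sum, ← Finset.mul_sum] at h1
  linarith

/-- The trial shifts: logarithmic profiles centred in the inner box, zero otherwise. -/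
def trialShift (L R : ℕ) (j i : box 2 L) : ℝ :=
  open Classical in if (j : Site 2) ∈ box 2 R then logShift L R j i else 0

lemma energy_zero_sq {d : ℕ} (Λ : Finset (Site d)) : energy (fun t => t ^ 2) Λ (fun _ => 0) = 0 := by
  simp [energy, bulkEnergy, boundaryEnergy]

/-- With `H` the harmonic sum, each centre in the inner box gains `H / 36` and pays at most `(1 /
16) * (2 / 9) * (H + 1) = (H + 1) / 72`; the other centres contribute zero. -/
lemma sum_trialShift_ge {L R : ℕ} (hR : 2 * R ≤ L) :
    (2 * (R : ℝ) + 1) ^ 2 * ((harmonicSum R - 1) / 72) ≤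
      ∑ j, (trialShift L R j j - 1 / 16 * energy (fun t => t ^ 2) (box 2 L) (trialShift L R j)) := by
  classical
  have h1 : ∀ j : box 2 L, (if (j : Site 2) ∈ box 2 R then (harmonicSum R - 1) / 72 else 0) ≤
      trialShift L R j j - 1 / 16 * energy (fun t => t ^ 2) (box 2 L) (trialShift L R j) := by
    intro j
    by_cases hj : (j : Site 2) ∈ box 2 R
    · have e : trialShift L R j = logShift L R j := by ext i; simp [trialShift, hj]
      have e0 : logShift L R j j = 1 / 36 * harmonicSum R := by
        simp [logShift, supNorm, logProfile_zero]
      rw [if_pos hj, e, e0, energy, boundaryEnergy_logShift hR hj]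
      linarith [bulkEnergy_logShift_le L R j]
    · have e : trialShift L R j = fun _ => 0 := by ext i; simp [trialShift, hj]
      rw [if_neg hj, e, energy_zero_sq]; simp
  refine le_trans (le_of_eq ?_) (Finset.sum_le_sum fun j _ => h1 j)
  rw [Finset.sum_coe_sort (box 2 L) fun j => if j ∈ box 2 R then (harmonicSum R - 1) / 72 else 0,
    ← Finset.sum_filter, Finset.sum_const, nsmul_eq_mul]
  have : (box 2 L).filter (fun j => j ∈ box 2 R) = box 2 R := by
    ext y
    rw [Finset.mem_filter, mem_box_iff_supNorm_le, mem_box_iff_supNorm_le]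
    omega
  rw [this, card_box_two]
  push_cast
  ring

end LogarithmicProfile

/-! ### Transfer to the random fields and asymptotics in `L`. -/

section Main

open SuperlinearWeight

lemma quenchedVariance_eq_tiltVar (V : ℝ → ℝ) (ε : ℝ≥0) (Λ : Finset (Site 2)) (η : Site 2 → ℝ)
    (i : Λ) : quenchedVariance V ε Λ η i =
      tiltVar (pinningMeasure ε Λ) (gibbsWeight V Λ) i (fun j : Λ => η j) := by
  simp only [quenchedVariance, gibbsMeasure, gibbsExponent_eq_linTilt, tiltVar]

lemma map_restrict_eq_gaussianPi {Ω : Type*} [MeasurableSpace Ω] {P : Measure Ω}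
    [IsProbabilityMeasure P] {η : Site 2 → Ω → ℝ} {v : ℝ≥0}
    (hlaw : ∀ i, HasLaw (η i) (gaussianReal 0 v) P) (hind : iIndepFun η P) (Λ : Finset (Site 2)) :
    P.map (fun ω (i : Λ) => η i ω) = gaussianPi Λ v := by
  have h := hind.precomp (g := fun i : Λ => (i : Site 2)) Subtype.val_injective
  rw [(iIndepFun_iff_map_fun_eq_pi_map fun i : Λ => (hlaw i).aemeasurable).1 h]
  congr 1
  ext1 i
  exact (hlaw i).map_eq

lemma integral_quenchedVariance {V : ℝ → ℝ} {ε : ℝ≥0} {Λ : Finset (Site 2)} {C : ℝ} {m : ℕ}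
    (hS : SuperlinearWeight (pinningMeasure ε Λ) (gibbsWeight V Λ) C m)
    {Ω : Type*} [MeasurableSpace Ω] {P : Measure Ω}
    [IsProbabilityMeasure P] {η : Site 2 → Ω → ℝ} {v : ℝ≥0}
    (hlaw : ∀ i, HasLaw (η i) (gaussianReal 0 v) P) (hind : iIndepFun η P) (i : Λ) :
    ∫ ω, quenchedVariance V ε Λ (fun j => η j ω) i ∂P =
      ∫ x, tiltVar (pinningMeasure ε Λ) (gibbsWeight V Λ) i x ∂(gaussianPi Λ v) := by
  simp_rw [quenchedVariance_eq_tiltVar]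
  rw [← map_restrict_eq_gaussianPi hlaw hind Λ, integral_map]
  · exact aemeasurable_pi_lambda _ fun i => (hlaw i).aemeasurable
  · exact (hS.stronglyMeasurable_tiltVar i).aestronglyMeasurable

/-- A volume-order error is negligible compared with `L ^ 2 * log L`. -/
lemma eventually_le_of_log_bound (K : ℝ) (hK : 0 ≤ K) {s : ℕ → ℝ}
    (hs : ∀ L : ℕ, (2 * ((L / 2 : ℕ) : ℝ) + 1) ^ 2 * ((harmonicSum (L / 2) - 1) / 72) -
      K * (2 * L + 1) ^ 2 ≤ s L) :
    ∀ᶠ L : ℕ in atTop, 1 / 144 ≤ 1 / ((L : ℝ) ^ 2 * Real.log L) * s L := by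
  have hlog : Tendsto (fun L : ℕ => Real.log L) atTop atTop :=
    Real.tendsto_log_atTop.comp tendsto_natCast_atTop_atTop
  filter_upwards [hlog.eventually_ge_atTop (144 * ((Real.log 2 + 1) / 72 + 9 * K) + Real.log 2 + 1),
    eventually_ge_atTop 2] with L h1 h2
  have hL : (2 : ℝ) ≤ L := by exact_mod_cast h2
  have hl2 : 0 < Real.log 2 := Real.log_pos (by norm_num)
  have hlL : 0 < Real.log L := Real.log_pos (by linarith)
  have hr : (L : ℝ) ≤ 2 * ((L / 2 : ℕ) : ℝ) + 1 := by
    have : L ≤ 2 * (L / 2) + 1 := by omega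
    exact_mod_cast this
  have hh : Real.log L - Real.log 2 ≤ harmonicSum (L / 2) := by
    refine le_trans ?_ (log_add_one_le_harmonicSum (L / 2))
    rw [← Real.log_div (by linarith) (by norm_num)]
    exact Real.log_le_log (by linarith) (by linarith)
  have h3 : (L : ℝ) ^ 2 * ((Real.log L - Real.log 2 - 1) / 72) ≤
      (2 * ((L / 2 : ℕ) : ℝ) + 1) ^ 2 * ((harmonicSum (L / 2) - 1) / 72) := by
    have : 0 ≤ Real.log L - Real.log 2 - 1 := by
      have : 0 ≤ 144 * ((Real.log 2 + 1) / 72 + 9 * K) := by positivity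
      linarith
    gcongr
  have h4 : K * (2 * L + 1) ^ 2 ≤ K * (9 * (L : ℝ) ^ 2) := by
    gcongr
    nlinarith
  have h5 := hs L
  rw [one_div_mul_eq_div, le_div_iff₀ (by positivity)]
  have h6 : (L : ℝ) ^ 2 * (1 / 144 * Real.log L) ≤
      (L : ℝ) ^ 2 * ((Real.log L - Real.log 2 - 1) / 72 - 9 * K) := by
    gcongr
    linarith
  linarith

end Main

end

theorem mainTheorem3 (V : ℝ → ℝ)
    (hV : Differentiable ℝ V) (hV' : Differentiable ℝ (deriv V))
    (hV'' : ∀ t, deriv (deriv V) t ≤ 1)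
    (hVpos : ∀ᶠ t in cocompact ℝ, 0 < V t)
    (hVgrowth : 1 < liminf (fun t : ℝ => ((Real.log (V t) / Real.log |t| : ℝ) : EReal))
      (cocompact ℝ)) :
    ∃ a : ℝ, 0 < a ∧
      ∀ (v : ℝ≥0), 0 < v → ∀ (ε : ℝ≥0),
      ∀ (Ω : Type*) [MeasurableSpace Ω] (P : Measure Ω) [IsProbabilityMeasure P]
        (η : Site 2 → Ω → ℝ),
        (∀ i, HasLaw (η i) (gaussianReal 0 v) P) → iIndepFun η P →
        (a : EReal) ≤ liminf (fun L : ℕ =>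
          ((1 / ((L : ℝ) ^ 2 * Real.log L) *
            ∑ i : box 2 L,
              ∫ ω, quenchedVariance V ε (box 2 L) (fun j => η j ω) i ∂P : ℝ) : EReal)) atTop := by
  refine ⟨1 / 144, by norm_num, fun v hv ε Ω _ P _ η hlaw hind => ?_⟩
  have hmid := add_sub_le_of_deriv2_le_one hV hV' hV''
  obtain ⟨C, hC, m, hlin⟩ := exists_mul_abs_le_add hV.continuous hVpos hVgrowth
  obtain ⟨M, hM⟩ : ∃ M : ℝ, ∀ t, |t| ≤ 1 → V t ≤ M := by
    obtain ⟨M, hM⟩ := (isCompact_Icc (a := (-1 : ℝ)) (b := 1)).bddAbove_image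
      hV.continuous.continuousOn
    exact ⟨M, fun t ht => hM ⟨t, abs_le.1 ht, rfl⟩⟩
  have hM' : ∀ t, |t| ≤ 1 → V t ≤ |M| := fun t ht => (hM t ht).trans (le_abs_self M)
  obtain ⟨D, hD⟩ := exists_partitionFn_zero_le hV.continuous hC hlin ε
  have hv0 : (0 : ℝ) < v := by exact_mod_cast hv
  have key := eventually_le_of_log_bound ((9 / 4 * |M| + |D|) / v) (by positivity)
    (s := fun L => ∑ i : box 2 L, ∫ ω, quenchedVariance V ε (box 2 L) (fun j => η j ω) i ∂P)
    fun L => by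
      obtain ⟨C₁, hS⟩ := exists_superlinearWeight hV.continuous hC hlin (abs_nonneg M) hM' L ε
      obtain ⟨C₂, hS₀⟩ := exists_superlinearWeight hV.continuous hC hlin (abs_nonneg M) hM' L 0
      simp only [integral_quenchedVariance hS hlaw hind]
      have h1 := mul_sum_integral_tiltVar_ge hmid (box 2 L) ε hS hS₀ hv.ne'
        (trialShift L (L / 2))
      have h2 := sum_trialShift_ge (L := L) (R := L / 2) (by omega)
      have h3 : -(9 / 4 * |M| * (box 2 L).card) ≤ Real.log
          (partitionFn (pinningMeasure 0 (box 2 L)) (gibbsWeight V (box 2 L)) 0) := by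
        rw [Real.le_log_iff_exp_le (hS₀.partitionFn_pos 0)]
        simpa using exp_le_partitionFn (abs_nonneg M) hM' (box 2 L) 0 0
          (hS₀.integrable_exp_linTilt 0)
      have h4 : Real.log (partitionFn (pinningMeasure ε (box 2 L)) (gibbsWeight V (box 2 L)) 0) ≤
          |D| * (box 2 L).card := by
        rw [Real.log_le_iff_le_exp (hS.partitionFn_pos 0)]
        refine (hD (box 2 L)).trans (Real.exp_le_exp.2 ?_)
        gcongr
        exact le_abs_self D
      have hcard : ((box 2 L).card : ℝ) = (2 * L + 1) ^ 2 := by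
        rw [card_box_two]; push_cast; ring
      rw [hcard] at h3 h4
      -- Dividing by `v` frees the main term of the field strength and leaves `1 / v` only in the
      -- volume-order error.
      refine le_of_mul_le_mul_left (le_trans ?_ h1) hv0
      have h5 := mul_le_mul_of_nonneg_left h2 hv0.le
      have h6 : (v : ℝ) * ((9 / 4 * |M| + |D|) / v * (2 * (L : ℝ) + 1) ^ 2) =
          (9 / 4 * |M| + |D|) * (2 * (L : ℝ) + 1) ^ 2 := by field_simp
      rw [mul_sub, h6]
      linarith
  refine le_liminf_of_le (by isBoundedDefault) ?_
  filter_upwards [key] with L hL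
  exact_mod_cast hL
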